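/- A parity game $G=\langle V,\Sigma,\Gamma,E,\iota,F\rangle$ consists of a finite vertex set $V=V_1\uplus V_2$, finite action sets $\Sigma$ and $\Gamma$ of players 1 and 2, total transition functions $E_1:V_1\times\Sigma\to V_2$ and $E_2:V_2\times\Gamma\to V_1$, an initial vertex $\iota\in V_1$ and a coloring $F:V\to\mathbb N$. An infinite word $w=a_0b_0a_1b_1\cdots\in(\Sigma\Gamma)^\omega$ generates the play $u_0v_0u_1v_1\cdots$ with $u_0=\iota$, $v_i=E_1(u_i,a_i)$, $u_{i+1}=E_2(v_i,b_i)$; the play is winning for player 2 if the largest color occurring infinitely often in it is even. A $k$-transducer is a tuple $T=\langle M,s,\eta,L\rangle$ with $|M|=k$, $s\in M$, $\eta:M\times\Gamma\to M$ and $L:M\to\Sigma$. A finite or infinite word $a_0b_0a_1b_1\cdots$ agrees with $T$ if, for every $i$, $a_i$ is the label $L(m_i)$ of the state $m_i$ that $T$ reaches from $s$ after reading $b_0\cdots b_{i-1}$ (so $a_0=L(s)$). Let $\mathcal L_k(G)$ be the set of infinite words that agree with some $k$-transducer and generate a play winning for player 2. The game $G$ is $k$-transducer live if for every finite word $\alpha\in(\Sigma\Gamma)^*$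 that agrees with some $k$-transducer there is $\beta\in(\Sigma\Gamma)^\omega$ with $\alpha\beta\in\mathcal L_k(G)$. Theorem. The following decision problem is in co-NP. Input: a parity game $G$, given explicitly by its transition tables, initial vertex and colors (numbers in binary), and a number $k\in\mathbb N$ in unary. Question: is $G$ $k$-transducer live? That is, there are a polynomial $q$ and a verifier running in polynomial time on a Turing machine, such that $G$ is not $k$-transducer live if and only if the verifier accepts the encoded input $(G,k)$ together with some binary certificate whose length is at most $q$ of the length of the encoded input. -/

import Mathlib

namespace TransducerLiveness

/-! ### Parity games -/

/-- A parity game. The vertex set is the disjoint union `V₁ ⊕ V₂` of the vertices of the two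
players, `A₁` and `A₂` are their action sets, and moves alternate. -/
structure ParityGame (V₁ V₂ A₁ A₂ : Type) where
  /-- transitions from the vertices of player 1 -/
  E₁ : V₁ → A₁ → V₂
  /-- transitions from the vertices of player 2 -/
  E₂ : V₂ → A₂ → V₁
  /-- the initial vertex -/
  init : V₁
  /-- the coloring -/
  color : V₁ ⊕ V₂ → ℕ

namespace ParityGame

variable {V₁ V₂ A₁ A₂ : Type}

/-- The player 1 vertices `u₀ u₁ u₂ …` of the play generated by `w = a₀ b₀ a₁ b₁ …`. -/
def pos₁ (G : ParityGame V₁ V₂ A₁ A₂) (w : Stream' (A₁ × A₂)) : ℕ → V₁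
  | 0 => G.init
  | i + 1 => G.E₂ (G.E₁ (G.pos₁ w i) (w.get i).1) (w.get i).2

/-- The player 2 vertices `v₀ v₁ v₂ …` of the play generated by `w = a₀ b₀ a₁ b₁ …`. -/
def pos₂ (G : ParityGame V₁ V₂ A₁ A₂) (w : Stream' (A₁ × A₂)) (i : ℕ) : V₂ :=
  G.E₁ (G.pos₁ w i) (w.get i).1

/-- The play `u₀ v₀ u₁ v₁ …` generated by an infinite word. -/
def play (G : ParityGame V₁ V₂ A₁ A₂) (w : Stream' (A₁ × A₂)) (j : ℕ) : V₁ ⊕ V₂ :=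
  if j % 2 = 0 then Sum.inl (G.pos₁ w (j / 2)) else Sum.inr (G.pos₂ w (j / 2))

/-- The color `c` occurs infinitely often in the play generated by `w`. -/
def OccursInfinitelyOften (G : ParityGame V₁ V₂ A₁ A₂) (w : Stream' (A₁ × A₂)) (c : ℕ) : Prop :=
  ∀ N : ℕ, ∃ j : ℕ, N ≤ j ∧ G.color (G.play w j) = c

/-- The play generated by `w` is winning for player 2: the largest color that occurs infinitely
often in it is even. -/
def WinningForPlayer2 (G : ParityGame V₁ V₂ A₁ A₂) (w : Stream' (A₁ × A₂)) : Prop :=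
  ∃ c : ℕ, IsGreatest {d : ℕ | G.OccursInfinitelyOften w d} c ∧ Even c

end ParityGame

/-! ### Transducers -/

/-- A transducer with state set `M`, output alphabet `A₁` and input alphabet `A₂`. -/
structure Transducer (A₁ A₂ M : Type) where
  /-- the initial state -/
  start : M
  /-- the transition function -/
  next : M → A₂ → M
  /-- the labeling function -/
  label : M → A₁

namespace Transducer

variable {A₁ A₂ M : Type}

/-- The state reached after reading a finite input word. -/
def run (T : Transducer A₁ A₂ M) (x : List A₂) : M :=
  x.foldl T.next T.start

/-- The output of the transducer after reading a finite input word. -/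
def output (T : Transducer A₁ A₂ M) (x : List A₂) : A₁ :=
  T.label (T.run x)

/-- The finite word `a₀ b₀ … aₙ bₙ` agrees with `T`: every `aᵢ` is the output of `T` after
`b₀ … bᵢ₋₁`. -/
def AgreesFin (T : Transducer A₁ A₂ M) (w : List (A₁ × A₂)) : Prop :=
  ∀ (i : ℕ) (hi : i < w.length), T.output ((w.take i).map Prod.snd) = (w[i]).1

/-- The infinite word `a₀ b₀ a₁ b₁ …` agrees with `T`: every `aᵢ` is the output of `T` after
`b₀ … bᵢ₋₁`. -/
def AgreesInf (T : Transducer A₁ A₂ M) (w : Stream' (A₁ × A₂)) : Prop :=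
  ∀ i : ℕ, T.output ((w.take i).map Prod.snd) = (w.get i).1

end Transducer

/-! ### Liveness -/

/-- The finite words that agree with some transducer with `k` states. -/
def finiteWords (A₁ A₂ : Type) (k : ℕ) : Set (List (A₁ × A₂)) :=
  {w | ∃ T : Transducer A₁ A₂ (Fin k), T.AgreesFin w}

/-- The `k`-transducer language of a game: the infinite words that agree with some transducer with
`k` states and generate a play that is winning for player 2. -/
def transducerLanguage {V₁ V₂ A₁ A₂ : Type} (k : ℕ) (G : ParityGame V₁ V₂ A₁ A₂) :
    Set (Stream' (A₁ × A₂)) :=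
  {w | (∃ T : Transducer A₁ A₂ (Fin k), T.AgreesInf w) ∧ G.WinningForPlayer2 w}

/-- `k`-transducer liveness of a parity game. -/
def IsTransducerLive {V₁ V₂ A₁ A₂ : Type} (k : ℕ) (G : ParityGame V₁ V₂ A₁ A₂) : Prop :=
  ∀ α ∈ finiteWords A₁ A₂ k, ∃ β : Stream' (A₁ × A₂),
    Stream'.appendStream' α β ∈ transducerLanguage k G

/-! ### Instances of the decision problem and their encoding -/

/-- An input of the decision problem: a finite parity game, whose four finite sets are listed as
`{0, …, n - 1}`, together with the bound `k`. -/
structure LivenessInstance where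
  /-- number of vertices of player 1 -/
  n₁ : ℕ
  /-- number of vertices of player 2 -/
  n₂ : ℕ
  /-- number of actions of player 1 -/
  m₁ : ℕ
  /-- number of actions of player 2 -/
  m₂ : ℕ
  /-- the game -/
  game : ParityGame (Fin n₁) (Fin n₂) (Fin m₁) (Fin m₂)
  /-- the number of states of the transducers -/
  k : ℕ

namespace LivenessInstance

/-- The game as a list of numbers: the four sizes, the initial vertex, the two transition tables
row by row, and the colors of all vertices. -/
def gameData (I : LivenessInstance) : List ℕ :=
  [I.n₁, I.n₂, I.m₁, I.m₂, (I.game.init : ℕ)]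
    ++ (List.finRange I.n₁).flatMap
        (fun u => (List.finRange I.m₁).map (fun a => (I.game.E₁ u a : ℕ)))
    ++ (List.finRange I.n₂).flatMap
        (fun v => (List.finRange I.m₂).map (fun b => (I.game.E₂ v b : ℕ)))
    ++ (List.finRange I.n₁).map (fun u => I.game.color (Sum.inl u))
    ++ (List.finRange I.n₂).map (fun v => I.game.color (Sum.inr v))

/-- The input word over the three letters `0`, `1` (that is, `some false`, `some true`) and a
separator (`none`): `k` in unary, then every number of the game in binary, each of them followed
by the separator. -/
def encode (I : LivenessInstance) : List (Option Bool) :=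
  List.replicate I.k (some true) ++ [none]
    ++ I.gameData.flatMap (fun n => (Computability.encodeNat n).map some ++ [none])

/-- The decision problem: is the given game `k`-transducer live for the given `k`? -/
def IsLive (I : LivenessInstance) : Prop :=
  IsTransducerLive I.k I.game

end LivenessInstance

/-! ### NP and co-NP -/

/-- The word on the input tape of a verifier: the encoded instance, followed by a binary
certificate (written in letters of its own). -/
def encodeWithCertificate {α Γ : Type} (enc : α → List Γ) (p : α × List Bool) :
    List (Γ ⊕ Bool) :=
  (enc p.1).map Sum.inl ++ p.2.map Sum.inr

/-- The decision problem `P`, whose instances `x` are encoded as words `enc x`, is in NP: there is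
a verifier that runs in polynomial time on a Turing machine such that `P x` holds if and only if
the verifier accepts `x` with some certificate of polynomially bounded length. -/
def InNP {α Γ : Type} (enc : α → List Γ) (P : α → Prop) : Prop :=
  ∃ (q : Polynomial ℕ) (R : α × List Bool → Bool),
    Nonempty (Turing.TM2ComputableInPolyTime (encodeWithCertificate enc)
      Computability.encodeBool R) ∧
    ∀ x : α, P x ↔ ∃ y : List Bool, y.length ≤ q.eval (enc x).length ∧ R (x, y) = true

/-- The decision problem `P` is in co-NP: its complement is in NP. -/
def InCoNP {α Γ : Type} (enc : α → List Γ) (P : α → Prop) : Prop :=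
  InNP enc (fun x => ¬ P x)

end TransducerLiveness

/-!
The complement of transducer liveness has short certificates because the existential quantifier over
transducers in the extension of a word can be eliminated. Suppose that `α` agrees with `T`, and let
`α'` extend `α` in agreement with `T` so that as few transducers with `k` states as possible agree
with `α'`. If one of these had an output different from that of `T` after some continuation, the
extension of `α'` by this continuation would agree with fewer transducers; hence all of them behave
like `T` from then on (`exists_distinguishing_extension`). Consequently `G` is not live if and only
if there are a transducer `T` with `k` states and a configuration (a state of `T` and a vertex of
player 1), reachable in the product of `T` and `G`, from which no play in agreement with `T` is
winning for player 2.

The latter is witnessed by a `IsRefutation`: a set of configurations that contains the given one and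
is closed under transitions, and for every even color `c` a rank that does not increase along the
transitions of the set that only visit colors up to `c` and decreases whenever `c` is visited. On a
winning play with largest recurring color `c`, the rank for `c` would decrease infinitely often
(`IsRefutation.not_live`). Conversely, if no play is winning, the number of configurations visiting
`c` that are reachable through colors up to `c` is such a rank: if it did not decrease there would be
a cycle with largest color `c`, and going around it forever would win
(`exists_isRefutation_of_not_live`). All of this has polynomial size, the path to the configuration
included, and can be checked locally.

For the polynomial time bound, a small structured programming language on stacks is compiled to
the machines `Turing.FinTM2` step by step (`StackProg.Exec.stepsTo`). Data are binary trees, stored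
on one stack as self-delimiting prefix codes, so that pairing and taking apart pairs cost one push
or pop; the only primitive programs with loops are those that drop, duplicate and exchange trees. On
top of this, `Poly f` states that `f` is computable in polynomial time, and is shown to be closed
under composition, pairing, case distinction, and folds and recursions in which every step increases
the size of the value by at most a polynomial in the size of the input. The verifier is an ordinary
function built from these (`poly_verifier`), and `Poly.polyTime` connects it to the input and output
of a machine.
-/

namespace TransducerLiveness

open Turing Function

/-! ### Structured stack programs and their compilation to Turing machines -/

/-- Structured programs over a family of stacks with alphabets `Γ k`. -/
inductive StackProg {K : Type} (Γ : K → Type) : Type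
  /-- do nothing -/
  | skip : StackProg Γ
  /-- push a letter -/
  | push (k : K) (a : Γ k) : StackProg Γ
  /-- pop a letter (`none` if the stack is empty) and branch on it -/
  | pop (k : K) (f : Option (Γ k) → StackProg Γ) : StackProg Γ
  /-- sequential composition -/
  | seq (p q : StackProg Γ) : StackProg Γ
  /-- as long as the stack `k` is nonempty, pop a letter `a` from it and run `f a` -/
  | loop (k : K) (f : Γ k → StackProg Γ) : StackProg Γ

namespace StackProg

variable {K : Type} {Γ : K → Type}

/-- Big-step semantics: `Exec p S S' t` says that `p` started on the stacks `S` terminates with the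
stacks `S'` after exactly `t` steps of the compiled machine. -/
inductive Exec [DecidableEq K] :
    StackProg Γ → (∀ k, List (Γ k)) → (∀ k, List (Γ k)) → ℕ → Prop
  | skip (S) : Exec skip S S 1
  | push (S) (k : K) (a : Γ k) : Exec (push k a) S (update S k (a :: S k)) 1
  | pop {S S'} {k : K} {f : Option (Γ k) → StackProg Γ} {t : ℕ}
      (h : Exec (f (S k).head?) (update S k (S k).tail) S' t) : Exec (pop k f) S S' (t + 1)
  | seq {S S' S''} {p q : StackProg Γ} {t t' : ℕ} (h : Exec p S S' t) (h' : Exec q S' S'' t') :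
      Exec (seq p q) S S'' (t' + t)
  | loop_nil {S} {k : K} {f : Γ k → StackProg Γ} (h : S k = []) : Exec (loop k f) S S 1
  | loop_cons {S S' S''} {k : K} {f : Γ k → StackProg Γ} {t t' : ℕ} {a : Γ k} {l : List (Γ k)}
      (h : S k = a :: l) (h' : Exec (f a) (update S k l) S' t) (h'' : Exec (loop k f) S' S'' t') :
      Exec (loop k f) S S'' (t' + t + 1)

/-- A program pushes at most one letter per step. -/
theorem Exec.length_le [DecidableEq K] {p : StackProg Γ} {S S' : ∀ k, List (Γ k)} {t : ℕ}
    (h : Exec p S S' t) (k : K) : (S' k).length ≤ (S k).length + t := by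
  induction h with
  | skip S => omega
  | push S k' a =>
    by_cases hk : k = k'
    · subst hk; simp
    · simp [update_of_ne hk]
  | @pop S S' k' f t h ih =>
    by_cases hk : k = k'
    · subst hk
      simp only [update_self, List.length_tail] at ih
      omega
    · rw [update_of_ne hk] at ih; omega
  | seq h h' ih ih' => omega
  | loop_nil h => omega
  | @loop_cons S S' S'' k' f t t' a l h h' h'' ih ih' =>
    by_cases hk : k = k'
    · subst hk
      rw [update_self] at ih
      rw [h, List.length_cons]
      omega
    · rw [update_of_ne hk] at ih; omega

/-- The labels of the machine compiled from a program. -/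
def Label : StackProg Γ → Type
  | skip => Unit
  | push _ _ => Unit
  | pop _ f => Option (Σ o, (f o).Label)
  | seq p q => p.Label ⊕ q.Label
  | loop _ f => Option (Σ a, (f a).Label)

theorem finite_label [∀ k, Finite (Γ k)] : ∀ p : StackProg Γ, Finite p.Label
  | skip => inferInstanceAs (Finite Unit)
  | push _ _ => inferInstanceAs (Finite Unit)
  | pop _ f =>
    have := fun o => finite_label (f o)
    inferInstanceAs (Finite (Option (Σ o, (f o).Label)))
  | seq p q =>
    have := finite_label p
    have := finite_label q
    inferInstanceAs (Finite (p.Label ⊕ q.Label))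
  | loop _ f =>
    have := fun a => finite_label (f a)
    inferInstanceAs (Finite (Option (Σ a, (f a).Label)))

/-- The label at which the execution of a program starts. -/
def entry : (p : StackProg Γ) → p.Label
  | skip => ()
  | push _ _ => ()
  | pop _ _ => (none : Option _)
  | seq p _ => Sum.inl p.entry
  | loop _ _ => (none : Option _)

/-- The statement at each label of a program whose labels are placed at `emb` among the labels `Λ`
of a machine, and which continues at `exit`. The internal state of the machine holds the result of
the last pop on each stack. -/
def compile [DecidableEq K] {Λ : Type} : (p : StackProg Γ) → (p.Label → Λ) → Λ → p.Label →
    TM2.Stmt Γ Λ (∀ k, Option (Γ k))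
  | skip, _, exit, _ => .goto fun _ => exit
  | push k a, _, exit, _ => .push k (fun _ => a) (.goto fun _ => exit)
  | pop k f, emb, _, none =>
    .pop k (fun v o => update v k o) (.goto fun v => emb (some ⟨v k, (f (v k)).entry⟩))
  | pop _ f, emb, exit, some ⟨o, l⟩ => (f o).compile (fun l => emb (some ⟨o, l⟩)) exit l
  | seq p q, emb, _, Sum.inl l => p.compile (fun l => emb (Sum.inl l)) (emb (Sum.inr q.entry)) l
  | seq _ q, emb, exit, Sum.inr l => q.compile (fun l => emb (Sum.inr l)) exit l
  | loop k f, emb, exit, none =>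
    .pop k (fun v o => update v k o) (.goto fun v =>
      match v k with
      | none => exit
      | some a => emb (some ⟨a, (f a).entry⟩))
  | loop _ f, emb, _, some ⟨a, l⟩ =>
    (f a).compile (fun l => emb (some ⟨a, l⟩)) (emb (none : Option _)) l

/-- The machine with program `M` moves from the configuration `c` to `c'` in `n` steps. -/
def StepsTo [DecidableEq K] {Λ σ : Type} (M : Λ → TM2.Stmt Γ Λ σ) (n : ℕ)
    (c c' : TM2.Cfg Γ Λ σ) : Prop :=
  (flip bind (TM2.step M))^[n] (some c) = some c'

theorem StepsTo.trans [DecidableEq K] {Λ σ : Type} {M : Λ → TM2.Stmt Γ Λ σ} {n n' : ℕ}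
    {c c' c'' : TM2.Cfg Γ Λ σ} (h : StepsTo M n c c') (h' : StepsTo M n' c' c'') :
    StepsTo M (n' + n) c c'' := by
  unfold StepsTo at *
  rw [iterate_add_apply, h, h']

theorem StepsTo.one [DecidableEq K] {Λ σ : Type} {M : Λ → TM2.Stmt Γ Λ σ} {l : Λ} {v : σ}
    {S : ∀ k, List (Γ k)} {c : TM2.Cfg Γ Λ σ} (h : TM2.stepAux (M l) v S = c) :
    StepsTo M 1 ⟨some l, v, S⟩ c := by
  subst h; rfl

/-- Correctness of the compilation, for a program whose labels are part of a larger machine. -/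
theorem Exec.stepsTo [DecidableEq K] {p : StackProg Γ} {S S' : ∀ k, List (Γ k)} {t : ℕ}
    (h : Exec p S S' t) {Λ : Type} (M : Λ → TM2.Stmt Γ Λ (∀ k, Option (Γ k))) (emb : p.Label → Λ)
    (exit : Λ) (hM : ∀ l, M (emb l) = p.compile emb exit l) (v : ∀ k, Option (Γ k)) :
    ∃ v', StepsTo M t ⟨some (emb p.entry), v, S⟩ ⟨some exit, v', S'⟩ := by
  induction h generalizing Λ v with
  | skip S =>
    refine ⟨v, StepsTo.one ?_⟩
    rw [hM]; rfl
  | push S k a =>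
    refine ⟨v, StepsTo.one ?_⟩
    rw [hM]; rfl
  | @pop S S' k f t h ih =>
    obtain ⟨v', hv'⟩ := ih M (fun l => emb (some ⟨_, l⟩)) exit (fun l => hM (some ⟨_, l⟩))
      (update v k (S k).head?)
    refine ⟨v', StepsTo.trans (StepsTo.one ?_) hv'⟩
    have hlab : ∀ o, o = (S k).head? → (some (emb (some ⟨o, (f o).entry⟩)) : Option Λ) =
        some (emb (some ⟨(S k).head?, (f (S k).head?).entry⟩)) := by
      rintro _ rfl; rfl
    rw [hM]
    exact congrArg (fun o => (⟨o, _, _⟩ : TM2.Cfg Γ Λ _))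
      (hlab _ (update_self (β := fun k => Option (Γ k)) k _ v))
  | seq h h' ih ih' =>
    obtain ⟨v', hv'⟩ := ih M (fun l => emb (Sum.inl l)) _ (fun l => hM (Sum.inl l)) v
    obtain ⟨v'', hv''⟩ := ih' M (fun l => emb (Sum.inr l)) _ (fun l => hM (Sum.inr l)) v'
    exact ⟨v'', StepsTo.trans hv' hv''⟩
  | @loop_nil S k f h =>
    refine ⟨update v k none, StepsTo.one ?_⟩
    rw [hM]
    have : update S k [] = S := by rw [← h, update_eq_self]
    simp [entry, compile, h, this]
  | @loop_cons S S' S'' k f t t' a l h h' h'' ih ih' =>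
    obtain ⟨v', hv'⟩ := ih M (fun l => emb (some ⟨_, l⟩)) _ (fun l => hM (some ⟨_, l⟩))
      (update v k (some a))
    obtain ⟨v'', hv''⟩ := ih' M emb exit hM v'
    refine ⟨v'', StepsTo.trans (StepsTo.one ?_) (StepsTo.trans hv' hv'')⟩
    rw [hM]
    simp [entry, compile, h]

end StackProg

/-- The stacks of the machines below: the input, the output, a data stack, two auxiliary stacks
and a unary counter. -/
inductive Stk
  | inp | out | dat | auxA | auxB | cnt
  deriving DecidableEq

instance : Fintype Stk :=
  ⟨{.inp, .out, .dat, .auxA, .auxB, .cnt}, by rintro (_ | _) <;> decide⟩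

/-- The stack alphabets: only the input stack does not hold bits. -/
def stkAlphabet (γ : Type) : Stk → Type
  | .inp => γ
  | .out => Bool
  | .dat => Bool
  | .auxA => Bool
  | .auxB => Bool
  | .cnt => Bool

instance {γ : Type} [Fintype γ] : ∀ k, Fintype (stkAlphabet γ k)
  | .inp => inferInstanceAs (Fintype γ)
  | .out => inferInstanceAs (Fintype Bool)
  | .dat => inferInstanceAs (Fintype Bool)
  | .auxA => inferInstanceAs (Fintype Bool)
  | .auxB => inferInstanceAs (Fintype Bool)
  | .cnt => inferInstanceAs (Fintype Bool)

/-- The stack contents, listed. -/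
def stackFamily {γ : Type} (i : List γ) (o d a b c : List Bool) : ∀ k, List (stkAlphabet γ k)
  | .inp => i
  | .out => o
  | .dat => d
  | .auxA => a
  | .auxB => b
  | .cnt => c

section updateStacks

variable {γ : Type} (i i' : List γ) (o d a b c x : List Bool)

theorem update_inp : update (stackFamily i o d a b c) .inp i' = stackFamily i' o d a b c := by
  funext k; cases k <;> rfl

theorem update_out : update (stackFamily i o d a b c) .out x = stackFamily i x d a b c := by
  funext k; cases k <;> rfl

theorem update_dat : update (stackFamily i o d a b c) .dat x = stackFamily i o x a b c := by
  funext k; cases k <;> rfl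

theorem update_auxA : update (stackFamily i o d a b c) .auxA x = stackFamily i o d x b c := by
  funext k; cases k <;> rfl

theorem update_auxB : update (stackFamily i o d a b c) .auxB x = stackFamily i o d a x c := by
  funext k; cases k <;> rfl

theorem update_cnt : update (stackFamily i o d a b c) .cnt x = stackFamily i o d a b x := by
  funext k; cases k <;> rfl

end updateStacks

/-- A function is computable in polynomial time if a stack program computes it in polynomial
time. -/
theorem polyTime_of_exec {α γ : Type} [Fintype γ] (ea : α → List γ) (f : α → Bool)
    (p : StackProg (stkAlphabet γ)) (P : Polynomial ℕ)
    (h : ∀ a, ∃ t ≤ P.eval (ea a).length,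
      p.Exec (stackFamily (ea a) [] [] [] [] []) (stackFamily [] [f a] [] [] [] []) t) :
    Nonempty (TM2ComputableInPolyTime ea Computability.encodeBool f) := by
  classical
  have := StackProg.finite_label p
  let tm : FinTM2 :=
    { K := Stk
      k₀ := .inp
      k₁ := .out
      Γ := stkAlphabet γ
      Λ := Option p.Label
      main := some p.entry
      ΛFin := Fintype.ofFinite _
      σ := ∀ k, Option (stkAlphabet γ k)
      initialState := fun _ => none
      m := fun l => match l with
        | none => .load (fun _ _ => none) .halt
        | some l => p.compile some none l }
  refine ⟨⟨⟨tm, Equiv.refl _, Equiv.refl _⟩, P + 1, fun a => ?_⟩⟩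
  choose t ht hE using h
  have hinit : initList tm (List.map (Equiv.refl γ).invFun (ea a)) =
      ⟨some (some p.entry), fun _ => none, stackFamily (ea a) [] [] [] [] []⟩ := by
    unfold initList
    congr 1
    funext k
    cases k <;> first | rfl | exact List.map_id _
  have hhalt : haltList tm (List.map (Equiv.refl Bool).invFun (Computability.encodeBool (f a))) =
      ⟨none, fun _ => none, stackFamily [] [f a] [] [] [] []⟩ := by
    unfold haltList
    congr 1
    funext k
    cases k <;> rfl
  refine ⟨⟨1 + t a, ?_⟩, ?_⟩
  · obtain ⟨v', hv'⟩ := (hE a).stepsTo tm.m some none (fun _ => rfl) (fun _ => none)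
    have h1 := hv'.trans (StackProg.StepsTo.one (M := tm.m) (l := none) (v := v') (c := _) rfl)
    refine (congrArg _ (congrArg some hinit)).trans (Eq.trans h1 (congrArg some ?_))
    exact hhalt.symm
  · have := ht a
    simp only [Polynomial.eval_add, Polynomial.eval_one]
    omega

/-! ### Binary trees on a stack -/

/-- Binary trees, the universal data type of the programs below. -/
inductive BTree
  | leaf
  | node (l r : BTree)

namespace BTree

/-- The code of a tree in prefix notation. Codes are self-delimiting. -/
def code : BTree → List Bool
  | leaf => [false]
  | node l r => true :: (l.code ++ r.code)

/-- The size of a tree is the length of its code. -/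
def size (x : BTree) : ℕ := x.code.length

theorem size_leaf : size leaf = 1 := rfl

theorem size_node (l r : BTree) : size (node l r) = 1 + size l + size r := by
  simp only [size, code, List.length_cons, List.length_append]; omega

theorem size_pos (x : BTree) : 0 < x.size := by
  cases x
  · simp [size_leaf]
  · rw [size_node]; omega

end BTree

open BTree StackProg

/-- `Realizes p x y t`: on a data stack with the word `x` on top, the program `p` replaces `x` by
`y` in at most `t` steps. The other stacks are left as they were, and the auxiliary stacks are
empty before and after. -/
def Realizes {γ : Type} (p : StackProg (stkAlphabet γ)) (x y : List Bool) (t : ℕ) : Prop :=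
  ∀ i o rest, ∃ t' ≤ t, Exec p (stackFamily i o (x ++ rest) [] [] [])
    (stackFamily i o (y ++ rest) [] [] []) t'

section StackWords

variable {γ : Type}

theorem Realizes.mono {p : StackProg (stkAlphabet γ)} {x y : List Bool} {t t' : ℕ}
    (h : Realizes p x y t) (ht : t ≤ t') : Realizes p x y t' := by
  intro i o rest
  obtain ⟨s, hs, hE⟩ := h i o rest
  exact ⟨s, hs.trans ht, hE⟩

theorem Realizes.seq {p q : StackProg (stkAlphabet γ)} {x y z : List Bool} {t t' : ℕ}
    (h : Realizes p x y t) (h' : Realizes q y z t') : Realizes (.seq p q) x z (t + t') := by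
  intro i o rest
  obtain ⟨s, hs, hE⟩ := h i o rest
  obtain ⟨s', hs', hE'⟩ := h' i o rest
  exact ⟨s' + s, by omega, hE.seq hE'⟩

theorem Realizes.append {p : StackProg (stkAlphabet γ)} {x y : List Bool} {t : ℕ}
    (h : Realizes p x y t) (z : List Bool) : Realizes p (x ++ z) (y ++ z) t := by
  intro i o rest
  simpa only [List.append_assoc] using h i o (z ++ rest)

theorem Realizes.length_le {p : StackProg (stkAlphabet γ)} {x y : List Bool} {t : ℕ}
    (h : Realizes p x y t) : y.length ≤ x.length + t := by
  obtain ⟨s, hs, hE⟩ := h [] [] []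
  have h1 := hE.length_le .dat
  have h2 : (y ++ []).length ≤ (x ++ []).length + s := h1
  simp only [List.append_nil] at h2
  omega

/-! ### Rules for the concrete stacks -/

section concreteRules

variable {i : List γ} {o d a b c : List Bool} {S S' : ∀ k, List (stkAlphabet γ k)} {t t' : ℕ}

theorem exec_pushDat (s : Bool) (i : List γ) (o d a b c : List Bool) :
    Exec (.push .dat s) (stackFamily i o d a b c) (stackFamily i o (s :: d) a b c) 1 :=
  (congrArg (fun S => Exec _ _ S 1) (update_dat ..)).mp
    (Exec.push (Γ := stkAlphabet γ) (stackFamily i o d a b c) .dat s)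

theorem exec_pushA (s : Bool) (i : List γ) (o d a b c : List Bool) :
    Exec (.push .auxA s) (stackFamily i o d a b c) (stackFamily i o d (s :: a) b c) 1 :=
  (congrArg (fun S => Exec _ _ S 1) (update_auxA ..)).mp
    (Exec.push (Γ := stkAlphabet γ) (stackFamily i o d a b c) .auxA s)

theorem exec_pushB (s : Bool) (i : List γ) (o d a b c : List Bool) :
    Exec (.push .auxB s) (stackFamily i o d a b c) (stackFamily i o d a (s :: b) c) 1 :=
  (congrArg (fun S => Exec _ _ S 1) (update_auxB ..)).mp
    (Exec.push (Γ := stkAlphabet γ) (stackFamily i o d a b c) .auxB s)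

theorem exec_pushCnt (s : Bool) (i : List γ) (o d a b c : List Bool) :
    Exec (.push .cnt s) (stackFamily i o d a b c) (stackFamily i o d a b (s :: c)) 1 :=
  (congrArg (fun S => Exec _ _ S 1) (update_cnt ..)).mp
    (Exec.push (Γ := stkAlphabet γ) (stackFamily i o d a b c) .cnt s)

theorem exec_pushOut (s : Bool) (i : List γ) (o d a b c : List Bool) :
    Exec (.push .out s) (stackFamily i o d a b c) (stackFamily i (s :: o) d a b c) 1 :=
  (congrArg (fun S => Exec _ _ S 1) (update_out ..)).mp
    (Exec.push (Γ := stkAlphabet γ) (stackFamily i o d a b c) .out s)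

theorem exec_popDat {f : Option Bool → StackProg (stkAlphabet γ)} {s : Bool}
    (h : Exec (f (some s)) (stackFamily i o d a b c) S' t) :
    Exec (.pop .dat f) (stackFamily i o (s :: d) a b c) S' (t + 1) :=
  Exec.pop (Γ := stkAlphabet γ) (k := .dat)
    ((congrArg (fun S => Exec (f (some s)) S S' t) (update_dat ..)).mpr h)

theorem exec_loopA {f : Bool → StackProg (stkAlphabet γ)} {s : Bool}
    (h : Exec (f s) (stackFamily i o d a b c) S t) (h' : Exec (.loop .auxA f) S S' t') :
    Exec (.loop .auxA f) (stackFamily i o d (s :: a) b c) S' (t' + t + 1) :=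
  Exec.loop_cons (Γ := stkAlphabet γ) (k := .auxA) rfl
    ((congrArg (fun S' => Exec (f s) S' S t) (update_auxA ..)).mpr h) h'

theorem exec_loopB {f : Bool → StackProg (stkAlphabet γ)} {s : Bool}
    (h : Exec (f s) (stackFamily i o d a b c) S t) (h' : Exec (.loop .auxB f) S S' t') :
    Exec (.loop .auxB f) (stackFamily i o d a (s :: b) c) S' (t' + t + 1) :=
  Exec.loop_cons (Γ := stkAlphabet γ) (k := .auxB) rfl
    ((congrArg (fun S' => Exec (f s) S' S t) (update_auxB ..)).mpr h) h'

theorem exec_loopCnt {f : Bool → StackProg (stkAlphabet γ)} {s : Bool}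
    (h : Exec (f s) (stackFamily i o d a b c) S t) (h' : Exec (.loop .cnt f) S S' t') :
    Exec (.loop .cnt f) (stackFamily i o d a b (s :: c)) S' (t' + t + 1) :=
  Exec.loop_cons (Γ := stkAlphabet γ) (k := .cnt) rfl
    ((congrArg (fun S' => Exec (f s) S' S t) (update_cnt ..)).mpr h) h'

theorem exec_loopInp {f : γ → StackProg (stkAlphabet γ)} {s : γ}
    (h : Exec (f s) (stackFamily i o d a b c) S t) (h' : Exec (.loop .inp f) S S' t') :
    Exec (.loop .inp f) (stackFamily (s :: i) o d a b c) S' (t' + t + 1) :=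
  Exec.loop_cons (Γ := stkAlphabet γ) (k := .inp) rfl
    ((congrArg (fun S' => Exec (f s) S' S t) (update_inp ..)).mpr h) h'

end concreteRules

/-! ### Realizing transformations of the data stack -/

theorem Realizes.skip (x : List Bool) : Realizes (γ := γ) .skip x x 1 :=
  fun _ _ _ => ⟨1, le_rfl, .skip _⟩

theorem Realizes.push (b : Bool) (x : List Bool) :
    Realizes (γ := γ) (.push .dat b) x (b :: x) 1 := by
  intro i o rest
  exact ⟨1, le_rfl, exec_pushDat ..⟩

theorem Realizes.pop {f : Option Bool → StackProg (stkAlphabet γ)} {b : Bool} {x y : List Bool}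
    {t : ℕ} (h : Realizes (f (some b)) x y t) : Realizes (.pop .dat f) (b :: x) y (t + 1) := by
  intro i o rest
  obtain ⟨s, hs, hE⟩ := h i o rest
  exact ⟨s + 1, by omega, exec_popDat hE⟩

/-- Push a word on the data stack. -/
def pushWord : List Bool → StackProg (stkAlphabet γ)
  | [] => .skip
  | b :: x => .seq (pushWord x) (.push .dat b)

theorem Realizes.pushWord (x y : List Bool) :
    Realizes (γ := γ) (pushWord x) y (x ++ y) (x.length + 1) := by
  induction x with
  | nil => exact (Realizes.skip y).mono (by simp)
  | cons b x ih => exact (ih.seq (Realizes.push b _)).mono (by simp)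

/-! ### Moving trees between stacks -/

/-- Move the letters of `auxA` back to the data stack. -/
def restoreA : StackProg (stkAlphabet γ) := .loop .auxA fun b => .push .dat b

/-- Move the letters of `auxB` back to the data stack. -/
def restoreB : StackProg (stkAlphabet γ) := .loop .auxB fun b => .push .dat b

theorem exec_restoreA (i : List γ) (o d a b c : List Bool) :
    Exec restoreA (stackFamily i o d a b c) (stackFamily i o (a.reverse ++ d) [] b c)
      (2 * a.length + 1) := by
  induction a generalizing d with
  | nil => exact Exec.loop_nil (Γ := stkAlphabet γ) rfl
  | cons s a ih =>
    have h2 := exec_loopA (f := fun s => .push .dat s) (exec_pushDat s i o d a b c) (ih _)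
    have e : 2 * (s :: a).length + 1 = 2 * a.length + 1 + 1 + 1 := by simp; omega
    rw [List.reverse_cons, List.append_assoc, e]
    exact h2

theorem exec_restoreB (i : List γ) (o d a b c : List Bool) :
    Exec restoreB (stackFamily i o d a b c) (stackFamily i o (b.reverse ++ d) a [] c)
      (2 * b.length + 1) := by
  induction b generalizing d with
  | nil => exact Exec.loop_nil (Γ := stkAlphabet γ) rfl
  | cons s b ih =>
    have h2 := exec_loopB (f := fun s => .push .dat s) (exec_pushDat s i o d a b c) (ih _)
    have e : 2 * (s :: b).length + 1 = 2 * b.length + 1 + 1 + 1 := by simp; omega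
    rw [List.reverse_cons, List.append_assoc, e]
    exact h2

/-- Take one tree off the data stack, running `act s` for every letter `s` of its code. The counter
holds the number of trees that are still to be read. -/
def parseLoop (act : Bool → StackProg (stkAlphabet γ)) : StackProg (stkAlphabet γ) :=
  .loop .cnt fun _ => .pop .dat fun s =>
    match s with
    | none => .skip
    | some true => .seq (act true) (.seq (.push .cnt true) (.push .cnt true))
    | some false => act false

/-- If `act s` transforms the two auxiliary stacks by `F s` in `k` steps, parsing a tree transforms
them by all letters of the code. -/
theorem exec_parseLoop {act : Bool → StackProg (stkAlphabet γ)}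
    {F : List Bool × List Bool → Bool → List Bool × List Bool} {k : ℕ}
    (hact : ∀ s i o d ab c, Exec (act s) (stackFamily i o d ab.1 ab.2 c)
      (stackFamily i o d (F ab s).1 (F ab s).2 c) k) (x : BTree) :
    ∃ t ≤ (k + 4) * x.size, ∀ i o d ab c S' t',
      Exec (parseLoop act)
        (stackFamily i o d (x.code.foldl F ab).1 (x.code.foldl F ab).2 c) S' t' →
      Exec (parseLoop act) (stackFamily i o (x.code ++ d) ab.1 ab.2 (true :: c)) S' (t' + t) := by
  induction x with
  | leaf =>
    refine ⟨k + 2, by rw [size_leaf]; omega, ?_⟩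
    intro i o d ab c S' t' h
    exact exec_loopCnt (t := k + 1) (exec_popDat (hact false i o d ab c)) h
  | node l r ihl ihr =>
    obtain ⟨t1, ht1, h1⟩ := ihl
    obtain ⟨t2, ht2, h2⟩ := ihr
    refine ⟨t2 + t1 + (k + 4), by rw [size_node]; nlinarith, ?_⟩
    intro i o d ab c S' t' h
    have h3 : Exec (parseLoop act) (stackFamily i o (l.code ++ (r.code ++ d)) (F ab true).1
        (F ab true).2 (true :: true :: c)) S' (t' + t2 + t1) := by
      apply h1
      apply h2
      simpa [code] using h
    have e : t' + (t2 + t1 + (k + 4)) = (t' + t2 + t1) + (1 + 1 + k + 1) + 1 := by omega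
    rw [e]
    refine exec_loopCnt (exec_popDat ?_) h3
    rw [← List.append_assoc]
    exact Exec.seq (hact true _ _ _ _ _) (Exec.seq (exec_pushCnt ..) (exec_pushCnt ..))

/-- Take one tree off the data stack, running `act s` for every letter `s` of its code. -/
def parse (act : Bool → StackProg (stkAlphabet γ)) : StackProg (stkAlphabet γ) :=
  .seq (.push .cnt true) (parseLoop act)

theorem exec_parse {act : Bool → StackProg (stkAlphabet γ)}
    {F : List Bool × List Bool → Bool → List Bool × List Bool} {k : ℕ}
    (hact : ∀ s i o d ab c, Exec (act s) (stackFamily i o d ab.1 ab.2 c)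
      (stackFamily i o d (F ab s).1 (F ab s).2 c) k) (x : BTree) (i : List γ)
    (o d : List Bool) (ab : List Bool × List Bool) :
    ∃ t ≤ (k + 6) * x.size, Exec (parse act) (stackFamily i o (x.code ++ d) ab.1 ab.2 [])
      (stackFamily i o d (x.code.foldl F ab).1 (x.code.foldl F ab).2 []) t := by
  obtain ⟨t, ht, h⟩ := exec_parseLoop hact x
  have hx := x.size_pos
  refine ⟨1 + t + 1, by nlinarith, Exec.seq (exec_pushCnt ..) ?_⟩
  exact h _ _ _ _ _ _ _ (Exec.loop_nil (Γ := stkAlphabet γ) rfl)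

/-- Remove the top tree. -/
def dropTree : StackProg (stkAlphabet γ) := parse fun _ => .skip

theorem Realizes.dropTree (x : BTree) :
    Realizes (γ := γ) dropTree x.code [] (7 * x.size) := by
  intro i o d
  obtain ⟨t, ht, h⟩ := exec_parse (γ := γ) (act := fun _ => .skip) (F := fun ab _ => ab) (k := 1)
    (fun _ _ _ _ _ _ => .skip _) x i o d ([], [])
  refine ⟨t, ht, ?_⟩
  have e : List.foldl (fun (ab : List Bool × List Bool) (_ : Bool) => ab) ([], []) x.code
      = ([], []) := by
    generalize x.code = l
    induction l with
    | nil => rfl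
    | cons _ _ ih => exact ih
  rw [e] at h
  exact h

theorem foldl_pushA (l : List Bool) (ab : List Bool × List Bool) :
    l.foldl (fun (ab : List Bool × List Bool) s => (s :: ab.1, ab.2)) ab
      = (l.reverse ++ ab.1, ab.2) := by
  induction l generalizing ab with
  | nil => rfl
  | cons s l ih => rw [List.foldl_cons, ih]; simp

theorem foldl_pushB (l : List Bool) (ab : List Bool × List Bool) :
    l.foldl (fun (ab : List Bool × List Bool) s => (ab.1, s :: ab.2)) ab
      = (ab.1, l.reverse ++ ab.2) := by
  induction l generalizing ab with
  | nil => rfl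
  | cons s l ih => rw [List.foldl_cons, ih]; simp

theorem foldl_pushAB (l : List Bool) (ab : List Bool × List Bool) :
    l.foldl (fun (ab : List Bool × List Bool) s => (s :: ab.1, s :: ab.2)) ab
      = (l.reverse ++ ab.1, l.reverse ++ ab.2) := by
  induction l generalizing ab with
  | nil => rfl
  | cons s l ih => rw [List.foldl_cons, ih]; simp

/-- Duplicate the top tree. Both auxiliary stacks receive its code in reverse, so that emptying
them onto the data stack one after the other yields two copies. -/
def dupTree : StackProg (stkAlphabet γ) :=
  .seq (parse fun s => .seq (.push .auxA s) (.push .auxB s)) (.seq restoreA restoreB)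

theorem Realizes.dupTree (x : BTree) :
    Realizes (γ := γ) dupTree x.code (x.code ++ x.code) (14 * x.size) := by
  intro i o d
  obtain ⟨t, ht, h⟩ := exec_parse (γ := γ) (act := fun s => .seq (.push .auxA s) (.push .auxB s))
    (F := fun ab s => (s :: ab.1, s :: ab.2)) (k := 2)
    (fun s i o d ab c => Exec.seq (exec_pushA s i o d ab.1 ab.2 c) (exec_pushB _ _ _ _ _ _ _))
    x i o d ([], [])
  rw [foldl_pushAB] at h
  have hx := x.size_pos
  refine ⟨(2 * x.size + 1) + (2 * x.size + 1) + t, by nlinarith,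
    Exec.seq h (Exec.seq (S' := stackFamily i o (x.code ++ d) [] x.code.reverse []) ?_ ?_)⟩
  · simpa [BTree.size] using exec_restoreA i o d x.code.reverse x.code.reverse []
  · simpa [BTree.size] using exec_restoreB i o (x.code ++ d) [] x.code.reverse []

/-- Exchange the two topmost trees. The first one to be put aside is the first to be put back. -/
def swapTree : StackProg (stkAlphabet γ) :=
  .seq (parse fun s => .push .auxA s) (.seq (parse fun s => .push .auxB s)
    (.seq restoreA restoreB))

theorem Realizes.swapTree (x y : BTree) :
    Realizes (γ := γ) swapTree (x.code ++ y.code) (y.code ++ x.code)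
      (10 * (x.size + y.size)) := by
  intro i o d
  obtain ⟨t, ht, h⟩ := exec_parse (γ := γ) (act := fun s => .push .auxA s)
    (F := fun ab s => (s :: ab.1, ab.2)) (k := 1)
    (fun s i o d ab c => exec_pushA s i o d ab.1 ab.2 c) x i o (y.code ++ d) ([], [])
  obtain ⟨t', ht', h'⟩ := exec_parse (γ := γ) (act := fun s => .push .auxB s)
    (F := fun ab s => (ab.1, s :: ab.2)) (k := 1)
    (fun s i o d ab c => exec_pushB s i o d ab.1 ab.2 c) y i o d (x.code.reverse, [])
  rw [foldl_pushA] at h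
  rw [foldl_pushB] at h'
  have hx := x.size_pos
  have hy := y.size_pos
  refine ⟨(2 * y.size + 1) + (2 * x.size + 1) + t' + t, by omega, ?_⟩
  rw [List.append_assoc]
  simp only [List.append_nil] at h h'
  refine Exec.seq h (Exec.seq h' (Exec.seq (S' := stackFamily i o (x.code ++ d) [] y.code.reverse [])
    ?_ ?_))
  · simpa [BTree.size] using exec_restoreA i o d x.code.reverse y.code.reverse []
  · simpa [BTree.size] using exec_restoreB i o (x.code ++ d) [] y.code.reverse []

end StackWords

/-! ### Functions computable in polynomial time -/

section PolyFunctions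

/-- A type whose elements are represented by binary trees. -/
class Enc (α : Type) where
  /-- the tree that represents an element -/
  enc : α → BTree

open Enc (enc)

/-- The size of the tree that represents an element. -/
def esize {α : Type} [Enc α] (a : α) : ℕ := (enc a).size

instance : Enc Bool := ⟨fun b => bif b then node leaf leaf else leaf⟩

/-- Numbers are represented in unary. -/
instance : Enc ℕ := ⟨fun n => n.rec leaf fun _ x => node leaf x⟩

instance : Enc Unit := ⟨fun _ => leaf⟩

instance {α β : Type} [Enc α] [Enc β] : Enc (α × β) := ⟨fun p => node (enc p.1) (enc p.2)⟩

instance {α : Type} [Enc α] : Enc (List α) := ⟨fun l => l.rec leaf fun a _ x => node (enc a) x⟩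

variable {α β δ σ τ : Type} [Enc α] [Enc β] [Enc δ] [Enc σ] [Enc τ]

theorem esize_pos (a : α) : 0 < esize a := size_pos _

theorem esize_pair (p : α × β) : esize p = 1 + esize p.1 + esize p.2 := size_node _ _

theorem esize_nil : esize ([] : List α) = 1 := rfl

theorem esize_cons (a : α) (l : List α) : esize (a :: l) = 1 + esize a + esize l := size_node _ _

theorem esize_nat (n : ℕ) : esize n = 2 * n + 1 := by
  induction n with
  | zero => rfl
  | succ n ih =>
    have : esize (n + 1) = 1 + 1 + esize n := size_node _ _
    omega

theorem esize_bool (b : Bool) : esize b ≤ 3 := by cases b <;> decide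

theorem length_le_esize (l : List α) : l.length ≤ esize l := by
  induction l with
  | nil => simp
  | cons a l ih => rw [esize_cons, List.length_cons]; omega

theorem esize_le_of_mem {a : α} {l : List α} (h : a ∈ l) : esize a ≤ esize l := by
  induction l with
  | nil => simp at h
  | cons b l ih =>
    rw [esize_cons]
    rcases List.mem_cons.1 h with rfl | h
    · omega
    · have := ih h; omega

theorem esize_drop_le (l : List α) (i : ℕ) : esize (l.drop i) ≤ esize l := by
  induction l generalizing i with
  | nil => simp
  | cons b l ih =>
    cases i with
    | zero => simp
    | succ i => rw [List.drop_succ_cons, esize_cons]; have := ih i; omega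

/-- Polynomials over `ℕ` are monotone. -/
theorem eval_le_eval (P : Polynomial ℕ) {m n : ℕ} (h : m ≤ n) : P.eval m ≤ P.eval n := by
  rw [Polynomial.eval_eq_sum, Polynomial.eval_eq_sum]
  exact Finset.sum_le_sum fun i _ => Nat.mul_le_mul_left _ (Nat.pow_le_pow_left h i)

/-- A function between represented types is computable in polynomial time: some program replaces
the code of the argument, on top of the data stack, by the code of the value. The program does not
touch the input stack, whose alphabet `γ` is therefore arbitrary. -/
@[fun_prop]
def Poly (f : α → β) : Prop :=
  ∀ γ : Type, ∃ (p : StackProg (stkAlphabet γ)) (P : Polynomial ℕ),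
    ∀ a, Realizes p (enc a).code (enc (f a)).code (P.eval (esize a))

theorem Poly.esize_le {f : α → β} (hf : Poly f) :
    ∃ P : Polynomial ℕ, ∀ a, esize (f a) ≤ P.eval (esize a) := by
  obtain ⟨p, P, h⟩ := hf Unit
  refine ⟨.X + P, fun a => ?_⟩
  rw [Polynomial.eval_add, Polynomial.eval_X]
  exact (h a).length_le

/-- A function that does not change the representing tree costs nothing. -/
theorem Poly.of_enc_eq {f : α → β} (h : ∀ a, enc (f a) = enc a) : Poly f := by
  refine fun γ => ⟨.skip, 1, fun a => ?_⟩
  rw [h, Polynomial.eval_one]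
  exact Realizes.skip _

@[fun_prop]
theorem Poly.id : Poly fun a : α => a := .of_enc_eq fun _ => rfl

@[fun_prop]
theorem Poly.comp {g : β → δ} {f : α → β} (hg : Poly g) (hf : Poly f) :
    Poly fun a => g (f a) := by
  intro γ
  obtain ⟨Q, hQ⟩ := hf.esize_le
  obtain ⟨p, P, h⟩ := hf γ
  obtain ⟨p', P', h'⟩ := hg γ
  refine ⟨.seq p p', P + P'.comp Q, fun a => ((h a).seq (h' (f a))).mono ?_⟩
  rw [Polynomial.eval_add, Polynomial.eval_comp]
  have := eval_le_eval P' (hQ a)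
  omega

@[fun_prop]
theorem Poly.const (b : β) : Poly fun _ : α => b := by
  intro γ
  refine ⟨.seq dropTree (pushWord (enc b).code), .C 7 * .X + .C ((enc b).code.length + 1),
    fun a => ?_⟩
  have h := (Realizes.dropTree (γ := γ) (enc a)).seq (Realizes.pushWord (enc b).code [])
  rw [List.append_nil] at h
  refine h.mono ?_
  simp [esize]

@[fun_prop]
theorem Poly.pair {f : α → β} {g : α → δ} (hf : Poly f) (hg : Poly g) :
    Poly fun a => (f a, g a) := by
  intro γ
  obtain ⟨Q, hQ⟩ := hf.esize_le
  obtain ⟨Q', hQ'⟩ := hg.esize_le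
  obtain ⟨p, P, h⟩ := hf γ
  obtain ⟨p', P', h'⟩ := hg γ
  refine ⟨.seq dupTree (.seq p (.seq swapTree (.seq p' (.seq swapTree (.push .dat true))))),
    .C 14 * .X + P + .C 10 * (Q + .X) + P' + .C 10 * (Q' + Q) + 1, fun a => ?_⟩
  have h1 := Realizes.dupTree (γ := γ) (enc a)
  have h2 := (h a).append (enc a).code
  have h3 := Realizes.swapTree (γ := γ) (enc (f a)) (enc a)
  have h4 := (h' a).append (enc (f a)).code
  have h5 := Realizes.swapTree (γ := γ) (enc (g a)) (enc (f a))
  have h6 := Realizes.push (γ := γ) true ((enc (f a)).code ++ (enc (g a)).code)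
  refine (h1.seq (h2.seq (h3.seq (h4.seq (h5.seq h6))))).mono ?_
  have := hQ a
  have := hQ' a
  simp only [esize] at *
  simp only [Polynomial.eval_add, Polynomial.eval_mul, Polynomial.eval_C, Polynomial.eval_X,
    Polynomial.eval_one]
  omega

@[fun_prop]
theorem Poly.fst : Poly (Prod.fst : α × β → α) := by
  intro γ
  refine ⟨.pop .dat fun _ => .seq swapTree dropTree, .C 20 * .X, fun a => ?_⟩
  have h1 := Realizes.swapTree (γ := γ) (enc a.1) (enc a.2)
  have h2 := (Realizes.dropTree (γ := γ) (enc a.2)).append (enc a.1).code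
  refine (Realizes.pop (b := true) (h1.seq h2)).mono ?_
  have := esize_pair a
  simp only [esize] at *
  simp only [Polynomial.eval_mul, Polynomial.eval_C, Polynomial.eval_X]
  omega

@[fun_prop]
theorem Poly.snd : Poly (Prod.snd : α × β → β) := by
  intro γ
  refine ⟨.pop .dat fun _ => dropTree, .C 20 * .X, fun a => ?_⟩
  have h2 := (Realizes.dropTree (γ := γ) (enc a.1)).append (enc a.2).code
  refine (Realizes.pop (b := true) h2).mono ?_
  have := esize_pair a
  simp only [esize] at *
  simp only [Polynomial.eval_mul, Polynomial.eval_C, Polynomial.eval_X]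
  omega

/-! ### Branching -/

/-- Evaluate a test given by a program on a copy of the top tree and branch on the result. -/
def testThen {γ : Type} (c p q : StackProg (stkAlphabet γ)) : StackProg (stkAlphabet γ) :=
  .seq dupTree (.seq c (.pop .dat fun b =>
    match b with
    | some true => .pop .dat fun _ => .pop .dat fun _ => p
    | _ => q))

/-- The program chosen by the test finds the stacks as they were before the test. -/
theorem exec_testThen {γ : Type} {c p q : StackProg (stkAlphabet γ)} {x : BTree} {b : Bool}
    {t : ℕ} (hc : Realizes c x.code (enc b).code t) {i : List γ} {o rest : List Bool}
    {S : ∀ k, List (stkAlphabet γ k)} {t' : ℕ}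
    (h : Exec (bif b then p else q) (stackFamily i o (x.code ++ rest) [] [] []) S t') :
    ∃ s ≤ 14 * x.size + t + 3 + t',
      Exec (testThen c p q) (stackFamily i o (x.code ++ rest) [] [] []) S s := by
  obtain ⟨s1, hs1, h1⟩ := Realizes.dupTree (γ := γ) x i o rest
  obtain ⟨s2, hs2, h2⟩ := (hc.append x.code) i o rest
  cases b with
  | false =>
    refine ⟨(t' + 1) + s2 + s1, by omega, Exec.seq h1 (Exec.seq h2 ?_)⟩
    exact exec_popDat h
  | true =>
    refine ⟨(t' + 1 + 1 + 1) + s2 + s1, by omega, Exec.seq h1 (Exec.seq h2 ?_)⟩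
    exact exec_popDat (exec_popDat (exec_popDat h))

/-- Branching on a test, where each branch only has to be correct when it is taken. -/
theorem Poly.of_branch {c : α → Bool} {f : α → β} (hc : Poly c)
    (h : ∀ b γ, ∃ (p : StackProg (stkAlphabet γ)) (P : Polynomial ℕ),
      ∀ a, c a = b → Realizes p (enc a).code (enc (f a)).code (P.eval (esize a))) : Poly f := by
  intro γ
  obtain ⟨c', C, hc⟩ := hc γ
  obtain ⟨p, P, hp⟩ := h true γ
  obtain ⟨q, Q, hq⟩ := h false γ
  refine ⟨testThen c' p q, .C 14 * .X + C + 3 + (P + Q), fun a => ?_⟩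
  have key : Realizes (bif c a then p else q) (enc a).code (enc (f a)).code
      ((P + Q).eval (esize a)) := by
    rw [Polynomial.eval_add]
    cases hca : c a with
    | true => exact (hp a hca).mono (by omega)
    | false => exact (hq a hca).mono (by omega)
  intro i o rest
  obtain ⟨t', ht', hE⟩ := key i o rest
  obtain ⟨s, hs, hE'⟩ := exec_testThen (hc a) hE
  refine ⟨s, ?_, hE'⟩
  simp only [esize] at *
  simp only [Polynomial.eval_add, Polynomial.eval_mul, Polynomial.eval_C, Polynomial.eval_X,
    Polynomial.eval_ofNat] at *
  omega

@[fun_prop]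
theorem Poly.cond {c : α → Bool} {f g : α → β} (hc : Poly c) (hf : Poly f) (hg : Poly g) :
    Poly fun a => bif c a then f a else g a := by
  refine .of_branch hc fun b γ => ?_
  obtain ⟨p, P, hp⟩ := hf γ
  obtain ⟨q, Q, hq⟩ := hg γ
  cases b
  · exact ⟨q, Q, fun a ha => by rw [ha]; exact hq a⟩
  · exact ⟨p, P, fun a ha => by rw [ha]; exact hp a⟩

/-- The lists that are not empty. -/
def isCons : List α → Bool
  | [] => false
  | _ :: _ => true

@[fun_prop]
theorem poly_isCons : Poly (isCons : List α → Bool) := by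
  intro γ
  refine ⟨.pop .dat fun b => match b with
    | some true => .seq dropTree (.seq dropTree (pushWord (enc true).code))
    | _ => pushWord (enc false).code, .C 30 * .X, fun a => ?_⟩
  cases a with
  | nil =>
    refine (Realizes.pop (b := false) (Realizes.pushWord (enc false).code [])).mono ?_
    simp [esize_nil, enc, code]
  | cons b l =>
    have h1 := (Realizes.dropTree (γ := γ) (enc b)).append (enc l).code
    have h2 := Realizes.dropTree (γ := γ) (enc l)
    have h3 := Realizes.pushWord (γ := γ) (enc true).code []
    refine (Realizes.pop (b := true) (h1.seq (h2.seq h3))).mono ?_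
    have := esize_pos b
    have := esize_pos l
    have h4 : (enc true).code.length = 3 := rfl
    rw [esize_cons, h4]
    simp only [esize] at *
    simp only [Polynomial.eval_mul, Polynomial.eval_C, Polynomial.eval_X]
    omega

/-- Case distinction on a list. The second branch needs no conversion, since `(a, b :: l)` and
`(a, (b, l))` are represented by the same tree. -/
theorem Poly.listCases {f : α → δ} {g : α × (β × List β) → δ} (hf : Poly f) (hg : Poly g) :
    Poly fun p : α × List β => match p.2 with
      | [] => f p.1
      | b :: l => g (p.1, (b, l)) := by
  have hf' : Poly fun p : α × List β => f p.1 := by fun_prop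
  have hc : Poly fun p : α × List β => isCons p.2 := by fun_prop
  refine .of_branch hc fun b γ => ?_
  obtain ⟨p, P, hp⟩ := hf' γ
  obtain ⟨q, Q, hq⟩ := hg γ
  cases b
  · refine ⟨p, P, fun a ha => ?_⟩
    rcases a with ⟨a, _ | ⟨b, l⟩⟩
    · exact hp (a, [])
    · cases ha
  · refine ⟨q, Q, fun a ha => ?_⟩
    rcases a with ⟨a, _ | ⟨b, l⟩⟩
    · cases ha
    · exact hq (a, (b, l))

/-! ### Iteration -/

/-- While loops: if the test `c` holds exactly before the first `n a` iterations of `body`, and both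
the number of iterations and the sizes of all intermediate values are polynomially bounded, the
loop is computed in polynomial time. -/
theorem Poly.while {c : τ → Bool} {body : τ → τ} {start : α → τ} {n : α → ℕ} (hc : Poly c)
    (hbody : Poly body) (hstart : Poly start) (B : Polynomial ℕ)
    (hn : ∀ a, n a ≤ B.eval (esize a))
    (hB : ∀ a, ∀ j ≤ n a, esize (body^[j] (start a)) ≤ B.eval (esize a))
    (hcont : ∀ a, ∀ j < n a, c (body^[j] (start a)) = true)
    (hdone : ∀ a, c (body^[n a] (start a)) = false) :
    Poly fun a => body^[n a] (start a) := by
  intro γ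
  obtain ⟨pc, C, hpc⟩ := hc γ
  obtain ⟨pb, Q, hpb⟩ := hbody γ
  obtain ⟨ps, R, hps⟩ := hstart γ
  -- The outcome of the test is left on the counter, which the loop empties again.
  let test := testThen pc (.push .cnt true) .skip
  let T := .C 14 * B + C.comp B + 4
  refine ⟨.seq ps (.seq test (.loop .cnt fun _ => .seq pb test)),
    R + T + B * (T + Q.comp B + 1) + 1, fun a i o rest => ?_⟩
  let s := fun j => body^[j] (start a)
  let N := esize a
  let mark := fun j => bif c (s j) then [true] else []
  have htest : ∀ j ≤ n a, ∃ t ≤ T.eval N,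
      Exec test (stackFamily i o ((enc (s j)).code ++ rest) [] [] [])
        (stackFamily i o ((enc (s j)).code ++ rest) [] [] (mark j)) t := by
    intro j hj
    have hs := hB a j hj
    obtain ⟨t, ht, hE⟩ := exec_testThen (hpc (s j)) (t' := 1) (i := i) (o := o) (rest := rest)
      (p := .push .cnt true) (q := .skip)
      (S := stackFamily i o ((enc (s j)).code ++ rest) [] [] (mark j)) (by
        simp only [mark]
        cases c (s j)
        · exact .skip _
        · exact exec_pushCnt ..)
    refine ⟨t, ?_, hE⟩
    have := eval_le_eval C hs
    simp only [esize, s, N] at *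
    simp only [T, Polynomial.eval_add, Polynomial.eval_mul, Polynomial.eval_C,
      Polynomial.eval_comp, Polynomial.eval_ofNat] at *
    omega
  have hloop : ∀ j k, j + k = n a → ∃ t ≤ k * ((T + Q.comp B + 1).eval N) + 1,
      Exec (.loop .cnt fun _ => .seq pb test)
        (stackFamily i o ((enc (s j)).code ++ rest) [] [] (mark j))
        (stackFamily i o ((enc (s (n a))).code ++ rest) [] [] []) t := by
    intro j k hk
    induction k generalizing j with
    | zero =>
      obtain rfl : j = n a := by omega
      refine ⟨1, by omega, ?_⟩
      have hm : mark (n a) = [] := by simp only [mark, s, hdone a, cond_false]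
      rw [hm]
      exact Exec.loop_nil (Γ := stkAlphabet γ) rfl
    | succ k ih =>
      have hm : mark j = [true] := by
        simp only [mark, s, hcont a j (by omega), cond_true]
      rw [hm]
      obtain ⟨t1, ht1, h1⟩ := hpb (s j) i o rest
      have hsj : body (s j) = s (j + 1) := (Function.iterate_succ_apply' ..).symm
      rw [hsj] at h1
      obtain ⟨t2, ht2, h2⟩ := htest (j + 1) (by omega)
      obtain ⟨t3, ht3, h3⟩ := ih (j + 1) (by omega)
      refine ⟨t3 + (t2 + t1) + 1, ?_, exec_loopCnt (Exec.seq h1 h2) h3⟩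
      have := eval_le_eval Q (hB a j (by omega))
      simp only [Polynomial.eval_add, Polynomial.eval_comp, Polynomial.eval_one, add_mul,
        one_mul, N, s] at *
      omega
  obtain ⟨t1, ht1, h1⟩ := hps a i o rest
  obtain ⟨t2, ht2, h2⟩ := htest 0 (by omega)
  obtain ⟨t3, ht3, h3⟩ := hloop 0 (n a) (by omega)
  refine ⟨t3 + t2 + t1, ?_, Exec.seq h1 (Exec.seq h2 h3)⟩
  have h4 : n a * ((T + Q.comp B + 1).eval N) ≤ (B * (T + Q.comp B + 1)).eval N := by
    rw [Polynomial.eval_mul]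
    exact Nat.mul_le_mul_right _ (hn a)
  have h5 : (R + T + B * (T + Q.comp B + 1) + 1).eval N
      = R.eval N + T.eval N + (B * (T + Q.comp B + 1)).eval N + 1 := by
    simp only [Polynomial.eval_add, Polynomial.eval_one]
  have ht1' : t1 ≤ R.eval N := ht1
  refine le_of_le_of_eq ?_ h5.symm
  omega

/-! ### Loops over lists and numbers -/

theorem esize_foldl_le {β σ : Type} [Enc σ] {B : ℕ} {F : σ → β → σ} {l : List β}
    (h : ∀ s, ∀ b ∈ l, esize (F s b) ≤ esize s + B) (s : σ) :
    esize (l.foldl F s) ≤ esize s + l.length * B := by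
  induction l generalizing s with
  | nil => simp
  | cons b l ih =>
    rw [List.foldl_cons, List.length_cons, Nat.add_mul]
    have h1 := ih (fun s b hb => h s b (List.mem_cons_of_mem _ hb)) (F s b)
    have h2 := h s b List.mem_cons_self
    omega

/-- A left fold whose intermediate values have polynomially bounded sizes. -/
theorem Poly.foldl_of_bound {l : α → List β} {start : α → σ} {F : α → σ → β → σ} (hl : Poly l)
    (hstart : Poly start) (hF : Poly fun p : (α × σ) × β => F p.1.1 p.1.2 p.2)
    (hB : ∃ B : Polynomial ℕ, ∀ a i,
      esize (((l a).take i).foldl (F a) (start a)) ≤ B.eval (esize a)) :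
    Poly fun a => (l a).foldl (F a) (start a) := by
  obtain ⟨B, hB⟩ := hB
  obtain ⟨L, hL⟩ := hl.esize_le
  let body : (α × σ) × List β → (α × σ) × List β := fun p => match p.2 with
    | [] => (p.1, [])
    | b :: l => ((p.1.1, F p.1.1 p.1.2 b), l)
  have hbody : Poly body := by
    refine Poly.listCases (f := fun p : α × σ => (p, ([] : List β)))
      (g := fun q : (α × σ) × (β × List β) => ((q.1.1, F q.1.1 q.1.2 q.2.1), q.2.2)) ?_ ?_
    · fun_prop
    · have : Poly fun q : (α × σ) × (β × List β) => F q.1.1 q.1.2 q.2.1 :=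
        hF.comp (f := fun q : (α × σ) × (β × List β) => (q.1, q.2.1)) (by fun_prop)
      exact .pair (.pair (by fun_prop) this) (by fun_prop)
  have hiter : ∀ a j, body^[j] ((a, start a), l a)
      = ((a, ((l a).take j).foldl (F a) (start a)), (l a).drop j) := by
    intro a
    generalize start a = s
    generalize l a = l
    intro j
    induction j generalizing l s with
    | zero => rfl
    | succ j ih =>
      rw [Function.iterate_succ_apply]
      cases l with
      | nil => simpa [body] using ih s []
      | cons b l => exact ih (F a s b) l
  have key := Poly.while (c := fun p : (α × σ) × List β => isCons p.2) (body := body)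
    (start := fun a => ((a, start a), l a)) (n := fun a => (l a).length) (by fun_prop) hbody
    (by fun_prop) (.X + B + L + 2)
    (fun a => by
      have h1 := length_le_esize (l a)
      have h2 := hL a
      simp only [Polynomial.eval_add]
      omega)
    (fun a j hj => by
      rw [hiter, esize_pair, esize_pair]
      have h1 := esize_drop_le (l a) j
      have h2 := hL a
      have h3 := hB a j
      simp only [Polynomial.eval_add, Polynomial.eval_X, Polynomial.eval_ofNat]
      omega)
    (fun a j hj => by
      simp only [hiter]
      rw [List.drop_eq_getElem_cons hj]
      rfl)
    (fun a => by
      simp only [hiter, List.drop_length]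
      rfl)
  have key' : Poly fun a => (body^[(l a).length] ((a, start a), l a)).1.2 := by fun_prop
  simpa only [hiter, List.take_length] using key'

/-- A left fold in which every step increases the size of the value by at most a polynomial in the
size of the input. -/
theorem Poly.foldl {l : α → List β} {start : α → σ} {F : α → σ → β → σ} (hl : Poly l)
    (hstart : Poly start) (hF : Poly fun p : (α × σ) × β => F p.1.1 p.1.2 p.2)
    (hB : ∃ B : Polynomial ℕ, ∀ a s, ∀ b ∈ l a, esize (F a s b) ≤ esize s + B.eval (esize a)) :
    Poly fun a => (l a).foldl (F a) (start a) := by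
  obtain ⟨B, hB⟩ := hB
  obtain ⟨L, hL⟩ := hl.esize_le
  obtain ⟨R, hR⟩ := hstart.esize_le
  refine .foldl_of_bound hl hstart hF ⟨R + L * B, fun a i => ?_⟩
  have h1 := esize_foldl_le (fun s b hb => hB a s b (List.mem_of_mem_take hb)) (start a)
    (l := (l a).take i)
  have h2 : ((l a).take i).length ≤ L.eval (esize a) :=
    (List.length_take_le' ..).trans ((length_le_esize _).trans (hL a))
  have h3 := Nat.mul_le_mul_right (B.eval (esize a)) h2
  have h4 := hR a
  rw [Polynomial.eval_add, Polynomial.eval_mul]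
  omega

/-- Unary numbers and lists of units have the same representation, so that recursion on numbers
reduces to folds over lists. -/
theorem Poly.replicate : Poly fun n : ℕ => List.replicate n () := by
  refine .of_enc_eq fun n => ?_
  induction n with
  | zero => rfl
  | succ n ih => exact congrArg (node leaf) ih

@[fun_prop]
theorem Poly.succ {f : α → ℕ} (hf : Poly f) : Poly fun a => f a + 1 := by
  have h : Poly fun n : ℕ => ((), n) := by fun_prop
  have h' : Poly fun p : Unit × ℕ => p.2 + 1 := .of_enc_eq fun _ => rfl
  exact (h'.comp h).comp hf

@[fun_prop]
theorem Poly.cons {f : α → β} {g : α → List β} (hf : Poly f) (hg : Poly g) :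
    Poly fun a => f a :: g a := by
  have h : Poly fun p : β × List β => p.1 :: p.2 := .of_enc_eq fun _ => rfl
  exact h.comp (hf.pair hg)

/-- Primitive recursion in which every step increases the size of the value by at most a polynomial
in the size of the input. -/
theorem Poly.natRec {n : α → ℕ} {start : α → σ} {F : α → ℕ → σ → σ} (hn : Poly n)
    (hstart : Poly start) (hF : Poly fun p : (α × σ) × ℕ => F p.1.1 p.2 p.1.2)
    (hB : ∃ B : Polynomial ℕ, ∀ a s, ∀ i < n a, esize (F a i s) ≤ esize s + B.eval (esize a)) :
    Poly fun a => (Nat.rec (start a) (F a) (n a) : σ) := by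
  obtain ⟨B, hB⟩ := hB
  obtain ⟨L, hL⟩ := hn.esize_le
  obtain ⟨R, hR⟩ := hstart.esize_le
  have hfold : ∀ a j, (List.replicate j ()).foldl
      (fun (p : ℕ × σ) _ => (p.1 + 1, F a p.1 p.2)) (0, start a)
        = (j, Nat.rec (start a) (F a) j) := by
    intro a j
    induction j with
    | zero => rfl
    | succ j ih => rw [List.replicate_succ', List.foldl_append, ih]; rfl
  have hrec : ∀ a, ∀ j ≤ n a, esize (Nat.rec (start a) (F a) j : σ)
      ≤ esize (start a) + j * B.eval (esize a) := by
    intro a j hj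
    induction j with
    | zero => simp
    | succ j ih =>
      have h1 := ih (by omega)
      have h2 := hB a (Nat.rec (start a) (F a) j) j (by omega)
      rw [Nat.add_mul]
      simp only at *
      omega
  have key := Poly.foldl_of_bound (l := fun a => List.replicate (n a) ())
    (start := fun a => (0, start a)) (F := fun a (p : ℕ × σ) _ => (p.1 + 1, F a p.1 p.2))
    (Poly.replicate.comp hn) (by fun_prop)
    (by
      have : Poly fun q : (α × (ℕ × σ)) × Unit => F q.1.1 q.1.2.1 q.1.2.2 :=
        hF.comp (f := fun q : (α × (ℕ × σ)) × Unit => ((q.1.1, q.1.2.2), q.1.2.1)) (by fun_prop)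
      exact .pair (by fun_prop) this)
    ⟨1 + L + (R + L * B), fun a i => by
      rw [List.take_replicate, hfold, esize_pair]
      have h1 := hrec a (min i (n a)) (by omega)
      have h2 := hL a
      rw [esize_nat] at h2
      have h3 := hR a
      have h4 : min i (n a) * B.eval (esize a) ≤ L.eval (esize a) * B.eval (esize a) :=
        Nat.mul_le_mul_right _ (by omega)
      simp only [esize_nat, Polynomial.eval_add, Polynomial.eval_mul, Polynomial.eval_one]
      omega⟩
  have key' := Poly.snd.comp key
  simpa only [hfold] using key'

/-! ### Arithmetic -/

@[fun_prop]
theorem Poly.add {f g : α → ℕ} (hf : Poly f) (hg : Poly g) : Poly fun a => f a + g a := by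
  have h := Poly.natRec (F := fun (_ : α) _ s => s + 1) hg hf (by fun_prop)
    ⟨2, fun a s i _ => by simp [esize_nat]; omega⟩
  refine (funext fun a => ?_ : (fun a => f a + g a) = _) ▸ h
  generalize g a = n
  induction n with
  | zero => rfl
  | succ n ih => exact congrArg (· + 1) ih

@[fun_prop]
theorem Poly.mul {f g : α → ℕ} (hf : Poly f) (hg : Poly g) : Poly fun a => f a * g a := by
  obtain ⟨P, hP⟩ := hf.esize_le
  have h := Poly.natRec (F := fun a _ s => s + f a) (start := fun _ => 0) hg (by fun_prop)
    (by fun_prop)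
    ⟨P, fun a s i _ => by have := hP a; simp only [esize_nat] at *; omega⟩
  refine (funext fun a => ?_ : (fun a => f a * g a) = _) ▸ h
  generalize g a = n
  induction n with
  | zero => rfl
  | succ n ih => exact congrArg (· + f a) ih

theorem Poly.tail : Poly (List.tail : List β → List β) := by
  have h := Poly.listCases (α := Unit) (β := β) (f := fun _ => ([] : List β))
    (g := fun p : Unit × (β × List β) => p.2.2) (by fun_prop) (by fun_prop)
  have h' := h.comp (f := fun l : List β => ((), l)) (by fun_prop)
  refine (funext fun l => ?_ : (List.tail : List β → List β) = _) ▸ h'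
  cases l <;> rfl

/-- The predecessor is the tail of a list of units, which is represented by the same tree. -/
theorem Poly.pred : Poly Nat.pred := by
  have h : Poly fun l : List Unit => l.length := by
    refine .of_enc_eq fun l => ?_
    induction l with
    | nil => rfl
    | cons _ l ih => exact congrArg (node leaf) ih
  have h' := h.comp (Poly.tail.comp Poly.replicate)
  refine (funext fun n => ?_ : Nat.pred = _) ▸ h'
  simp

@[fun_prop]
theorem Poly.sub {f g : α → ℕ} (hf : Poly f) (hg : Poly g) : Poly fun a => f a - g a := by
  have h := Poly.natRec (F := fun (_ : α) _ s => Nat.pred s) hg hf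
    (Poly.pred.comp (by fun_prop)) ⟨0, fun a s i _ => by simp [esize_nat]⟩
  refine (funext fun a => ?_ : (fun a => f a - g a) = _) ▸ h
  generalize g a = n
  induction n with
  | zero => rfl
  | succ n ih => exact congrArg Nat.pred ih

@[fun_prop]
theorem Poly.min {f g : α → ℕ} (hf : Poly f) (hg : Poly g) : Poly fun a => min (f a) (g a) := by
  have h : Poly fun a => f a - (f a - g a) := by fun_prop
  refine (funext fun a => ?_ : (fun a => Min.min (f a) (g a)) = _) ▸ h
  omega

@[fun_prop]
theorem Poly.decide_lt {f g : α → ℕ} (hf : Poly f) (hg : Poly g) :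
    Poly fun a => decide (f a < g a) := by
  have h : Poly fun a => isCons (List.replicate (g a - f a) ()) :=
    poly_isCons.comp (Poly.replicate.comp (by fun_prop))
  refine (funext fun a => ?_ : (fun a => decide (f a < g a)) = _) ▸ h
  rcases h : g a - f a with _ | n
  · simpa [isCons] using (by omega : g a ≤ f a)
  · simpa [isCons, List.replicate_succ] using (by omega : f a < g a)

/-! ### Booleans -/

@[fun_prop]
theorem Poly.and {f g : α → Bool} (hf : Poly f) (hg : Poly g) : Poly fun a => f a && g a := by
  have h : Poly fun a => bif f a then g a else false := by fun_prop
  refine (funext fun a => ?_ : (fun a => f a && g a) = _) ▸ h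
  cases f a <;> rfl

@[fun_prop]
theorem Poly.or {f g : α → Bool} (hf : Poly f) (hg : Poly g) : Poly fun a => f a || g a := by
  have h : Poly fun a => bif f a then true else g a := by fun_prop
  refine (funext fun a => ?_ : (fun a => f a || g a) = _) ▸ h
  cases f a <;> rfl

@[fun_prop]
theorem Poly.not {f : α → Bool} (hf : Poly f) : Poly fun a => !f a := by
  have h : Poly fun a => bif f a then false else true := by fun_prop
  refine (funext fun a => ?_ : (fun a => !f a) = _) ▸ h
  cases f a <;> rfl

/-- The test whether `P i` holds for all `i < n`. -/
def forallLT (n : ℕ) (P : ℕ → Bool) : Bool := n.rec true fun i b => b && P i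

theorem forallLT_eq_true {n : ℕ} {P : ℕ → Bool} : forallLT n P = true ↔ ∀ i < n, P i = true := by
  induction n with
  | zero => simp [forallLT]
  | succ n ih =>
    have : forallLT (n + 1) P = (forallLT n P && P n) := rfl
    rw [this, Bool.and_eq_true, ih]
    constructor
    · rintro ⟨h, h'⟩ i hi
      rcases Nat.lt_succ_iff_lt_or_eq.1 hi with hi | rfl
      exacts [h i hi, h']
    · exact fun h => ⟨fun i hi => h i (by omega), h n (by omega)⟩

theorem Poly.forallLT {n : α → ℕ} {P : α → ℕ → Bool} (hn : Poly n)
    (hP : Poly fun p : α × ℕ => P p.1 p.2) : Poly fun a => forallLT (n a) (P a) :=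
  Poly.natRec (F := fun a i b => b && P a i) hn (.const true)
    (by
      have : Poly fun p : (α × Bool) × ℕ => P p.1.1 p.2 :=
        hP.comp (f := fun p : (α × Bool) × ℕ => (p.1.1, p.2)) (by fun_prop)
      fun_prop)
    ⟨3, fun a s i _ => (esize_bool _).trans (by simp)⟩

/-! ### Lists -/

theorem esize_getD_le (l : List β) (i : ℕ) (d : β) :
    esize (l.getD i d) ≤ esize l + esize d := by
  rcases lt_or_ge i l.length with h | h
  · rw [List.getD_eq_getElem _ _ h]
    exact (esize_le_of_mem (List.getElem_mem h)).trans (by omega)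
  · rw [List.getD_eq_default _ _ h]; omega

@[fun_prop]
theorem Poly.getD {l : α → List β} {i : α → ℕ} {d : α → β} (hl : Poly l) (hi : Poly i)
    (hd : Poly d) : Poly fun a => (l a).getD (i a) (d a) := by
  have hdrop : Poly fun a => (l a).drop (i a) := by
    have h := Poly.natRec (F := fun (_ : α) _ (s : List β) => s.tail) hi hl
      (Poly.tail.comp (by fun_prop)) ⟨0, fun a s i _ => by
        rw [← List.drop_one]; simpa using esize_drop_le s 1⟩
    refine (funext fun a => ?_ : (fun a => (l a).drop (i a)) = _) ▸ h
    generalize i a = n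
    induction n with
    | zero => rfl
    | succ n ih => rw [← List.tail_drop, ih]
  have hhead := Poly.listCases (α := β) (β := β) (f := fun b => b) (g := fun q => q.2.1)
    (by fun_prop) (by fun_prop)
  have h := hhead.comp (hd.pair hdrop)
  refine (funext fun a => ?_ : (fun a => (l a).getD (i a) (d a)) = _) ▸ h
  rcases lt_or_ge (i a) (l a).length with h | h
  · simp only [List.getD_eq_getElem _ _ h, List.drop_eq_getElem_cons h]
  · simp only [List.getD_eq_default _ _ h, List.drop_eq_nil_of_le h]

@[fun_prop]
theorem Poly.length : Poly (List.length : List β → ℕ) := by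
  have h := Poly.foldl (l := fun l : List β => l) (start := fun _ => 0)
    (F := fun _ (s : ℕ) _ => s + 1) (by fun_prop) (by fun_prop) (by fun_prop)
    ⟨2, fun a s b _ => by simp [esize_nat]; omega⟩
  refine (funext fun l => ?_ : (List.length : List β → ℕ) = _) ▸ h
  simp [List.foldl_const]

theorem Poly.reverse : Poly (List.reverse : List β → List β) := by
  have h := Poly.foldl (l := fun l : List β => l) (start := fun _ => [])
    (F := fun _ (s : List β) b => b :: s) (by fun_prop) (by fun_prop) (by fun_prop)
    ⟨.X + 1, fun a s b hb => by
      have := esize_le_of_mem hb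
      rw [esize_cons, Polynomial.eval_add, Polynomial.eval_X, Polynomial.eval_one]
      omega⟩
  refine (funext fun l => ?_ : (List.reverse : List β → List β) = _) ▸ h
  simp

/-- A right fold in which every step increases the size of the value by at most a polynomial in the
size of the input. -/
theorem Poly.foldr {l : α → List β} {start : α → σ} {F : α → β → σ → σ} (hl : Poly l)
    (hstart : Poly start) (hF : Poly fun p : (α × σ) × β => F p.1.1 p.2 p.1.2)
    (hB : ∃ B : Polynomial ℕ, ∀ a s, ∀ b ∈ l a, esize (F a b s) ≤ esize s + B.eval (esize a)) :
    Poly fun a => (l a).foldr (F a) (start a) := by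
  have h := Poly.foldl (l := fun a => (l a).reverse) (start := start)
    (F := fun a s b => F a b s) (Poly.reverse.comp hl) hstart hF
    (by simpa only [List.mem_reverse] using hB)
  simpa only [List.foldl_reverse] using h

/-! ### From the data stack to the input and output stacks -/

/-- Read the input onto the data stack. This reverses the input. -/
def loadInput {γ : Type} [Enc γ] : StackProg (stkAlphabet γ) :=
  .loop .inp fun s : γ => .seq (pushWord (enc s).code) (.push .dat true)

theorem exec_loadInput {γ : Type} [Enc γ] {C : ℕ} (hC : ∀ s : γ, esize s ≤ C) (i l : List γ) :
    ∃ t ≤ i.length * (C + 3) + 1, Exec loadInput (stackFamily i [] (enc l).code [] [] [])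
      (stackFamily [] [] (enc (i.reverse ++ l)).code [] [] []) t := by
  induction i generalizing l with
  | nil => exact ⟨1, by omega, Exec.loop_nil (Γ := stkAlphabet γ) rfl⟩
  | cons s i ih =>
    obtain ⟨t, ht, h⟩ := ih (s :: l)
    obtain ⟨t', ht', h'⟩ := Realizes.pushWord (γ := γ) (enc s).code (enc l).code i [] []
    refine ⟨t + (1 + t') + 1, ?_, ?_⟩
    · have := hC s
      simp only [esize, size] at this
      rw [List.length_cons, Nat.add_mul]
      omega
    · simp only [List.append_nil] at h'
      rw [List.reverse_cons, List.append_assoc]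
      exact exec_loopInp (Exec.seq h' (exec_pushDat ..)) h

/-- Move a truth value from the data stack to the output stack. -/
def storeOutput {γ : Type} : StackProg (stkAlphabet γ) :=
  .pop .dat fun b => match b with
    | some true => .pop .dat fun _ => .pop .dat fun _ => .push .out true
    | _ => .push .out false

theorem exec_storeOutput {γ : Type} (b : Bool) :
    ∃ t ≤ 4, Exec (storeOutput (γ := γ)) (stackFamily [] [] (enc b).code [] [] [])
      (stackFamily [] [b] [] [] [] []) t := by
  cases b with
  | false => exact ⟨2, by omega, exec_popDat (exec_pushOut ..)⟩
  | true => exact ⟨4, by omega, exec_popDat (exec_popDat (exec_popDat (exec_pushOut ..)))⟩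

/-- A test on words that is computable in polynomial time as a function between represented types
is computable in polynomial time by a Turing machine that reads the word from its input. -/
theorem Poly.polyTime {α γ : Type} [Fintype γ] [Enc γ] {f : List γ → Bool} (hf : Poly f)
    (ea : α → List γ) :
    Nonempty (Turing.TM2ComputableInPolyTime ea Computability.encodeBool fun a => f (ea a)) := by
  obtain ⟨p, P, hp⟩ := (hf.comp Poly.reverse) γ
  obtain ⟨C, hC⟩ : ∃ C, ∀ s : γ, esize s ≤ C :=
    ⟨∑ s : γ, esize s, fun s => Finset.single_le_sum (f := fun s : γ => esize s)
      (fun _ _ => Nat.zero_le _) (Finset.mem_univ s)⟩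
  have hsize : ∀ l : List γ, esize l ≤ 1 + l.length * (C + 1) := by
    intro l
    induction l with
    | nil => simp [esize_nil]
    | cons s l ih =>
      have := hC s
      rw [esize_cons, List.length_cons, Nat.add_mul]
      omega
  refine polyTime_of_exec ea _ (.seq (.push .dat false) (.seq loadInput (.seq p storeOutput)))
    (1 + (.X * .C (C + 3) + 1) + P.comp (1 + .X * .C (C + 1)) + 4) fun a => ?_
  obtain ⟨t1, ht1, h1⟩ := exec_loadInput hC (ea a) []
  obtain ⟨t2, ht2, h2⟩ := hp (ea a).reverse [] [] []
  obtain ⟨t3, ht3, h3⟩ := exec_storeOutput (γ := γ) (f (ea a))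
  simp only [List.append_nil, List.reverse_reverse] at h1 h2
  refine ⟨t3 + t2 + t1 + 1, ?_, Exec.seq (exec_pushDat ..) (Exec.seq h1 (Exec.seq h2 h3))⟩
  have h4 := eval_le_eval P (hsize (ea a).reverse)
  rw [List.length_reverse] at h4
  simp only [Polynomial.eval_add, Polynomial.eval_mul, Polynomial.eval_comp, Polynomial.eval_X,
    Polynomial.eval_C, Polynomial.eval_one, Polynomial.eval_ofNat]
  omega

/-! ### Reading the input word -/

/-- A letter of the input word as three bits: whether it belongs to the certificate, whether it is
a bit (and not a separator), and its value. -/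
def letterBits : Option Bool ⊕ Bool → Bool × Bool × Bool
  | .inl none => (false, false, false)
  | .inl (some b) => (false, true, b)
  | .inr b => (true, true, b)

instance : Enc (Option Bool ⊕ Bool) := ⟨fun s => enc (letterBits s)⟩

@[fun_prop]
theorem poly_letterBits : Poly letterBits := .of_enc_eq fun _ => rfl

/-- Put one letter in front of a parsed word. A word is parsed into the list of the bit words that
precede its separators, and the list of the numbers `n` given by the blocks `1ⁿ0` of its
certificate. -/
def parseLetter (s : Option Bool ⊕ Bool) (p : List (List Bool) × List ℕ) :
    List (List Bool) × List ℕ :=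
  bif (letterBits s).1 then
    (p.1, bif (letterBits s).2.2 then (p.2.getD 0 0 + 1) :: p.2.tail else 0 :: p.2)
  else
    (bif (letterBits s).2.1 then ((letterBits s).2.2 :: p.1.getD 0 []) :: p.1.tail else [] :: p.1,
      p.2)

/-- A parsed input word: its length, the list of its bit words and the list of the numbers in its
certificate. -/
abbrev Parsed : Type := ℕ × List (List Bool) × List ℕ

/-- Parse an input word. -/
def parseInput (w : List (Option Bool ⊕ Bool)) : Parsed := (w.length, w.foldr parseLetter ([], []))

theorem esize_parseLetter_le (s : Option Bool ⊕ Bool) (p : List (List Bool) × List ℕ) :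
    esize (parseLetter s p) ≤ esize p + 10 := by
  have hb := fun b => esize_bool b
  rcases s with (_ | b) | (_ | _)
  · simp only [parseLetter, letterBits, esize_pair, cond_false, esize_cons, esize_nil]
    omega
  · rcases p with ⟨_ | ⟨h, t⟩, c⟩ <;>
    simp only [parseLetter, letterBits, esize_pair, cond_true, cond_false, esize_cons, esize_nil,
      List.getD_nil, List.getD_cons_zero, List.tail] <;>
    have := hb b <;> omega
  · simp only [parseLetter, letterBits, esize_pair, cond_true, cond_false, esize_cons, esize_nat]
    omega
  · rcases p with ⟨c, _ | ⟨h, t⟩⟩ <;>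
    simp only [parseLetter, letterBits, esize_pair, cond_true, esize_cons, esize_nil,
      List.getD_nil, List.getD_cons_zero, List.tail, esize_nat] <;>
    omega

attribute [fun_prop] Poly.tail

theorem poly_parseInput : Poly parseInput := by
  refine .pair (by fun_prop) ?_
  refine Poly.foldr (l := fun w : List (Option Bool ⊕ Bool) => w) (F := fun _ => parseLetter)
    (start := fun _ => ([], [])) (by fun_prop) (by fun_prop) ?_ ⟨10, fun a s b _ => ?_⟩
  · unfold parseLetter; fun_prop
  · simpa using esize_parseLetter_le b s

/-! ### Binary numbers -/

/-- The number with the given binary digits, least significant digit first, capped at `N`. -/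
def bitsValue (N : ℕ) (l : List Bool) : ℕ :=
  l.foldr (fun b v => min N (2 * v + bif b then 1 else 0)) 0

@[fun_prop]
theorem poly_bitsValue {N : α → ℕ} {l : α → List Bool} (hN : Poly N) (hl : Poly l) :
    Poly fun a => bitsValue (N a) (l a) := by
  obtain ⟨P, hP⟩ := hN.esize_le
  refine Poly.foldr (F := fun a b v => min (N a) (2 * v + bif b then 1 else 0)) hl (by fun_prop)
    (by fun_prop) ⟨P, fun a s b _ => ?_⟩
  have := hP a
  simp only [esize_nat] at *
  omega

theorem bitsValue_le (N : ℕ) (l : List Bool) : bitsValue N l ≤ N := by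
  cases l with
  | nil => exact Nat.zero_le _
  | cons b l => exact min_le_left _ _

/-- Comparison of the numbers with the given binary digits, least significant digit first. The most
significant digit in which the numbers differ decides, so later digits override earlier ones. -/
def leBits (a b : List Bool) : Bool :=
  (a.length + b.length).rec true fun i r =>
    bif a.getD i false then b.getD i false && r else b.getD i false || r

@[fun_prop]
theorem poly_leBits {f g : α → List Bool} (hf : Poly f) (hg : Poly g) :
    Poly fun a => leBits (f a) (g a) :=
  Poly.natRec (F := fun a i r =>
    bif (f a).getD i false then (g a).getD i false && r else (g a).getD i false || r)
    (by fun_prop) (by fun_prop) (by fun_prop) ⟨3, fun _ _ _ _ => (esize_bool _).trans (by simp)⟩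

/-! ### The verifier -/

namespace Parsed

variable (e : Parsed)

/-- The number of states of the transducers: the first bit word of the input is its unary code. -/
def numStates : ℕ := (e.2.1.getD 0 []).length

/-- The `j`-th number that describes the game, capped at the length of the input word so that its
unary representation has polynomial size. -/
def num (j : ℕ) : ℕ := bitsValue e.1 (e.2.1.getD (j + 1) [])

/-- The transitions of player 1. -/
def tgt₁ (u a : ℕ) : ℕ := e.num (5 + (u * e.num 2 + a))

/-- The transitions of player 2. -/
def tgt₂ (v b : ℕ) : ℕ := e.num (5 + e.num 0 * e.num 2 + (v * e.num 3 + b))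

/-- The binary digits of the color of the `j`-th vertex. The vertices of player 1 come first. Colors
are never converted to unary, as they may be exponentially large. -/
def colorBits (j : ℕ) : List Bool :=
  e.2.1.getD (5 + e.num 0 * e.num 2 + e.num 1 * e.num 3 + j + 1) []

/-- The initial state of the transducer in the certificate. The entries of the six tables in the
certificate are interleaved: the `i`-th entry of table `t` is the number at position `6 * i + t`.
Missing entries are read as `0`. -/
def certStart : ℕ := e.2.2.getD 5 0

/-- The labels of the transducer in the certificate. -/
def certLabel (m : ℕ) : ℕ := e.2.2.getD (6 * m) 0

/-- The transitions of the transducer in the certificate. -/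
def certNext (m b : ℕ) : ℕ := e.2.2.getD (6 * (m * e.num 3 + b) + 1) 0

/-- The path in the certificate: the number `0` stands for no move and `b + 1` for the action `b`
of player 2. -/
def certPath (i : ℕ) : ℕ := e.2.2.getD (6 * i + 2) 0

/-- The set of configurations in the certificate, given by the nonzero entries. -/
def certMem (m u : ℕ) : ℕ := e.2.2.getD (6 * (m * e.num 0 + u) + 3) 0

/-- The rank of a configuration in the certificate, with respect to the color of the `j`-th
vertex. -/
def certRank (j m u : ℕ) : ℕ :=
  e.2.2.getD (6 * ((j * e.numStates + m) * e.num 0 + u) + 4) 0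

/-- The vertex of player 2 that the transducer moves to. -/
def mid (p : ℕ × ℕ) : ℕ := e.tgt₁ p.2 (e.certLabel p.1)

/-- The configuration after the action `b` of player 2. -/
def next (p : ℕ × ℕ) (b : ℕ) : ℕ × ℕ := (e.certNext p.1 b, e.tgt₂ (e.mid p) b)

/-- One step along the path in the certificate. Entries that are not actions are ignored. -/
def pathStep (i : ℕ) (p : ℕ × ℕ) : ℕ × ℕ :=
  bif decide (0 < e.certPath i) && decide (e.certPath i - 1 < e.num 3) then
    e.next p (e.certPath i - 1)
  else p

/-- The configuration at the end of the path in the certificate. The length of the certificate is an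
upper bound for the length of the path. -/
def target : ℕ × ℕ := e.2.2.length.rec (e.certStart, e.num 4) e.pathStep

/-- The certificate contains a transducer. -/
def checkTransducer : Bool :=
  decide (e.certStart < e.numStates) &&
    forallLT e.numStates fun m => decide (e.certLabel m < e.num 2) &&
      forallLT (e.num 3) fun b => decide (e.certNext m b < e.numStates)

/-- The set in the certificate contains the end of the path and is closed under transitions. -/
def checkClosed : Bool :=
  decide (0 < e.certMem e.target.1 e.target.2) &&
    forallLT e.numStates fun m => forallLT (e.num 0) fun u =>
      !decide (0 < e.certMem m u) ||
        forallLT (e.num 3) fun b =>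
          decide (0 < e.certMem (e.next (m, u) b).1 (e.next (m, u) b).2)

/-- The condition on the ranks with respect to the color of the `j`-th vertex: they do not increase
along transitions through vertices of at most this color, and decrease if the color occurs. As the
colors visited are at most this color, it occurs if it is at most one of them. -/
def checkRank (j m u : ℕ) : Bool :=
  !decide (0 < e.certMem m u) ||
    (!leBits (e.colorBits u) (e.colorBits j) ||
      (!leBits (e.colorBits (e.num 0 + e.mid (m, u))) (e.colorBits j) ||
        forallLT (e.num 3) fun b =>
          decide (e.certRank j (e.next (m, u) b).1 (e.next (m, u) b).2 +
            (bif leBits (e.colorBits j) (e.colorBits u) ||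
              leBits (e.colorBits j) (e.colorBits (e.num 0 + e.mid (m, u))) then 1 else 0)
            < e.certRank j m u + 1)))

/-- The ranks in the certificate satisfy the conditions for all even colors. -/
def checkRanks : Bool :=
  forallLT (e.num 0 + e.num 1) fun j =>
    (e.colorBits j).getD 0 false ||
      forallLT e.numStates fun m => forallLT (e.num 0) fun u => e.checkRank j m u

/-- The verifier, on parsed inputs. -/
def accepts : Bool := e.checkTransducer && (e.checkClosed && e.checkRanks)

end Parsed

namespace Parsed

variable {e : α → Parsed}

@[fun_prop]
theorem poly_numStates (he : Poly e) : Poly fun x => (e x).numStates := by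
  unfold numStates; fun_prop

@[fun_prop]
theorem poly_num {j : α → ℕ} (he : Poly e) (hj : Poly j) : Poly fun x => (e x).num (j x) := by
  unfold num; fun_prop

@[fun_prop]
theorem poly_tgt₁ {u a : α → ℕ} (he : Poly e) (hu : Poly u) (ha : Poly a) :
    Poly fun x => (e x).tgt₁ (u x) (a x) := by
  unfold tgt₁; fun_prop

@[fun_prop]
theorem poly_tgt₂ {v b : α → ℕ} (he : Poly e) (hv : Poly v) (hb : Poly b) :
    Poly fun x => (e x).tgt₂ (v x) (b x) := by
  unfold tgt₂; fun_prop

@[fun_prop]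
theorem poly_colorBits {j : α → ℕ} (he : Poly e) (hj : Poly j) :
    Poly fun x => (e x).colorBits (j x) := by
  unfold colorBits; fun_prop

@[fun_prop]
theorem poly_certStart (he : Poly e) : Poly fun x => (e x).certStart := by
  unfold certStart; fun_prop

@[fun_prop]
theorem poly_certLabel {m : α → ℕ} (he : Poly e) (hm : Poly m) :
    Poly fun x => (e x).certLabel (m x) := by
  unfold certLabel; fun_prop

@[fun_prop]
theorem poly_certNext {m b : α → ℕ} (he : Poly e) (hm : Poly m) (hb : Poly b) :
    Poly fun x => (e x).certNext (m x) (b x) := by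
  unfold certNext; fun_prop

@[fun_prop]
theorem poly_certPath {i : α → ℕ} (he : Poly e) (hi : Poly i) :
    Poly fun x => (e x).certPath (i x) := by
  unfold certPath; fun_prop

@[fun_prop]
theorem poly_certMem {m u : α → ℕ} (he : Poly e) (hm : Poly m) (hu : Poly u) :
    Poly fun x => (e x).certMem (m x) (u x) := by
  unfold certMem; fun_prop

@[fun_prop]
theorem poly_certRank {j m u : α → ℕ} (he : Poly e) (hj : Poly j) (hm : Poly m) (hu : Poly u) :
    Poly fun x => (e x).certRank (j x) (m x) (u x) := by
  unfold certRank; fun_prop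

@[fun_prop]
theorem poly_mid {p : α → ℕ × ℕ} (he : Poly e) (hp : Poly p) : Poly fun x => (e x).mid (p x) := by
  unfold mid; fun_prop

@[fun_prop]
theorem poly_next {p : α → ℕ × ℕ} {b : α → ℕ} (he : Poly e) (hp : Poly p) (hb : Poly b) :
    Poly fun x => (e x).next (p x) (b x) := by
  unfold next; fun_prop

@[fun_prop]
theorem poly_pathStep {p : α → ℕ × ℕ} {i : α → ℕ} (he : Poly e) (hi : Poly i) (hp : Poly p) :
    Poly fun x => (e x).pathStep (i x) (p x) := by
  unfold pathStep; fun_prop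

/-- The size of a configuration on the path does not depend on the previous configuration, as its
components are table entries. -/
theorem esize_pathStep_le (e : Parsed) (i : ℕ) (p : ℕ × ℕ) :
    esize (e.pathStep i p) ≤ esize p + (3 * esize e + 3) := by
  unfold pathStep
  generalize e.certPath i - 1 = b
  cases decide (0 < e.certPath i) && decide (b < e.num 3)
  · simp only [cond_false]; omega
  · have h1 : esize (e.certNext p.1 b) ≤ esize e.2.2 + esize (0 : ℕ) := esize_getD_le _ _ _
    have h2 : e.tgt₂ (e.mid p) b ≤ e.1 := bitsValue_le _ _
    simp only [cond_true, next, esize_pair, esize_nat] at *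
    omega

@[fun_prop]
theorem poly_target (he : Poly e) : Poly fun x => (e x).target := by
  obtain ⟨P, hP⟩ := he.esize_le
  refine Poly.natRec (F := fun x i p => (e x).pathStep i p) (by fun_prop) (by fun_prop)
    (by fun_prop) ⟨.C 3 * P + 3, fun x s i _ => ?_⟩
  have h1 := esize_pathStep_le (e x) i s
  have h2 := hP x
  simp only [Polynomial.eval_add, Polynomial.eval_mul, Polynomial.eval_C, Polynomial.eval_ofNat]
  omega

theorem poly_checkTransducer : Poly checkTransducer := by
  refine .and (by fun_prop) (.forallLT (by fun_prop) (.and (by fun_prop) ?_))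
  exact .forallLT (by fun_prop) (by fun_prop)

theorem poly_checkClosed : Poly checkClosed := by
  refine .and (by fun_prop) (.forallLT (by fun_prop) (.forallLT (by fun_prop) (.or (by fun_prop)
    ?_)))
  exact .forallLT (by fun_prop) (by fun_prop)

@[fun_prop]
theorem poly_checkRank {j m u : α → ℕ} (he : Poly e) (hj : Poly j) (hm : Poly m) (hu : Poly u) :
    Poly fun x => (e x).checkRank (j x) (m x) (u x) := by
  refine .or (by fun_prop) (.or (by fun_prop) (.or (by fun_prop) ?_))
  exact .forallLT (by fun_prop) (by fun_prop)

theorem poly_checkRanks : Poly checkRanks := by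
  refine .forallLT (by fun_prop) (.or (by fun_prop) ?_)
  exact .forallLT (by fun_prop) (.forallLT (by fun_prop) (by fun_prop))

theorem poly_accepts : Poly accepts :=
  .and poly_checkTransducer (.and poly_checkClosed poly_checkRanks)

end Parsed

/-- The verifier, on words consisting of an encoded instance and a certificate. -/
def verifier (w : List (Option Bool ⊕ Bool)) : Bool := (parseInput w).accepts

theorem poly_verifier : Poly verifier := Parsed.poly_accepts.comp poly_parseInput

end PolyFunctions

/-! ### Configurations of a transducer playing a game -/

section Configurations

variable {V₁ V₂ A₁ A₂ M : Type} (G : ParityGame V₁ V₂ A₁ A₂) (T : Transducer A₁ A₂ M)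

/-- The vertex of player 2 that is reached when the transducer `T` moves. -/
def midVertex (p : M × V₁) : V₂ := G.E₁ p.2 (T.label p.1)

/-- The configuration (state of the transducer and vertex of player 1) after `T` has moved and
player 2 has answered with `b`. -/
def confNext (p : M × V₁) (b : A₂) : M × V₁ := (T.next p.1 b, G.E₂ (midVertex G T p) b)

/-- The configuration after the moves `x` of player 2. -/
def conf (x : List A₂) : M × V₁ := x.foldl (confNext G T) (T.start, G.init)

theorem foldl_confNext_fst (x : List A₂) (p : M × V₁) :
    (x.foldl (confNext G T) p).1 = x.foldl T.next p.1 := by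
  induction x generalizing p with
  | nil => rfl
  | cons b x ih => exact ih _

theorem conf_fst (x : List A₂) : (conf G T x).1 = T.run x := foldl_confNext_fst G T x _

theorem conf_append (x y : List A₂) :
    conf G T (x ++ y) = y.foldl (confNext G T) (conf G T x) := List.foldl_append

/-- The word that agrees with `T` and has the moves `b` of player 2. -/
def inducedWord (b : Stream' A₂) : Stream' (A₁ × A₂) := fun i => (T.output (b.take i), b.get i)

/-- The finite word that agrees with `T` and has the moves `x` of player 2. -/
def inducedList (x : List A₂) : List (A₁ × A₂) := x.mapIdx fun i b => (T.output (x.take i), b)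

theorem length_inducedList (x : List A₂) : (inducedList T x).length = x.length :=
  List.length_mapIdx

theorem map_snd_inducedList (x : List A₂) : (inducedList T x).map Prod.snd = x := by
  refine List.ext_getElem (by simp [length_inducedList]) fun i h h' => ?_
  simp [inducedList]

theorem map_snd_take (w : Stream' (A₁ × A₂)) (i : ℕ) :
    (w.take i).map Prod.snd = (w.map Prod.snd).take i := by
  induction i with
  | zero => rfl
  | succ i ih => rw [Stream'.take_succ', Stream'.take_succ', List.map_append, ih]; rfl

theorem agreesInf_iff (w : Stream' (A₁ × A₂)) :
    T.AgreesInf w ↔ w = inducedWord T (w.map Prod.snd) := by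
  unfold Transducer.AgreesInf
  simp only [map_snd_take]
  constructor
  · exact fun h => funext fun i => Prod.ext (h i).symm rfl
  · exact fun h i => (congrArg Prod.fst (congrFun h i)).symm

theorem agreesInf_inducedWord (b : Stream' A₂) : T.AgreesInf (inducedWord T b) :=
  (agreesInf_iff T _).2 rfl

theorem pos₁_inducedWord (b : Stream' A₂) (i : ℕ) :
    G.pos₁ (inducedWord T b) i = (conf G T (b.take i)).2 := by
  induction i with
  | zero => rfl
  | succ i ih =>
    rw [Stream'.take_succ', conf_append, ParityGame.pos₁, ih]
    have h := conf_fst G T (b.take i)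
    simp only [List.foldl_cons, List.foldl_nil, confNext, midVertex, h]
    rfl

theorem pos₂_inducedWord (b : Stream' A₂) (i : ℕ) :
    G.pos₂ (inducedWord T b) i = midVertex G T (conf G T (b.take i)) := by
  rw [ParityGame.pos₂, pos₁_inducedWord, midVertex, conf_fst]
  rfl

/-- The color `c` is visited in the configuration `p`. -/
def Hits (c : ℕ) (p : M × V₁) : Prop :=
  G.color (.inl p.2) = c ∨ G.color (.inr (midVertex G T p)) = c

/-- The colors visited in the configuration `p` are at most `c`. -/
def Below (c : ℕ) (p : M × V₁) : Prop :=
  G.color (.inl p.2) ≤ c ∧ G.color (.inr (midVertex G T p)) ≤ c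

variable {G T}

theorem Below.le_of_hits {c d : ℕ} {p : M × V₁} (h : Below G T c p) (h' : Hits G T d p) :
    d ≤ c := by
  rcases h' with rfl | rfl
  exacts [h.1, h.2]

theorem occursInfinitelyOften_inducedWord {b : Stream' A₂} {c : ℕ} :
    G.OccursInfinitelyOften (inducedWord T b) c ↔
      ∀ N, ∃ i, N ≤ i ∧ Hits G T c (conf G T (b.take i)) := by
  unfold ParityGame.OccursInfinitelyOften Hits
  constructor
  · intro h N
    obtain ⟨j, hj, hc⟩ := h (2 * N)
    refine ⟨j / 2, by omega, ?_⟩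
    unfold ParityGame.play at hc
    split_ifs at hc
    · rw [pos₁_inducedWord] at hc; exact .inl hc
    · rw [pos₂_inducedWord] at hc; exact .inr hc
  · intro h N
    obtain ⟨i, hi, hc | hc⟩ := h N
    · refine ⟨2 * i, by omega, ?_⟩
      rw [ParityGame.play, if_pos (by omega), pos₁_inducedWord]
      rwa [show 2 * i / 2 = i by omega]
    · refine ⟨2 * i + 1, by omega, ?_⟩
      rw [ParityGame.play, if_neg (by omega), pos₂_inducedWord]
      rwa [show (2 * i + 1) / 2 = i by omega]

theorem take_of_take_eq {b : Stream' A₂} {x : List A₂} (h : b.take x.length = x) {i : ℕ}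
    (hi : x.length ≤ i) : ∃ z, b.take i = x ++ z := by
  refine ⟨(b.drop x.length).take (i - x.length), ?_⟩
  have h1 := Stream'.append_take_drop x.length b
  rw [h] at h1
  refine Eq.trans (congrArg _ h1.symm) ?_
  clear h1 h
  generalize b.drop x.length = s
  induction x generalizing i with
  | nil => rfl
  | cons a x ih =>
    obtain ⟨i, rfl⟩ : ∃ j, i = j + 1 := ⟨i - 1, by simp at hi; omega⟩
    have := ih (i := i) (by simpa using hi)
    simp only [Stream'.cons_append_stream, Stream'.take_succ_cons, List.cons_append,
      List.length_cons, Nat.add_sub_add_right, this]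

/-! ### Refutations of liveness -/

/-- A configuration in the set `S` is reached by `T` when player 2 makes the moves `x`, the set is
closed under transitions, and for every vertex `w` of even color the rank `r w` does not increase
along the transitions of `S` that only visit colors up to that of `w`, and decreases if the color
of `w` is visited. Such data show that no play through `S` is winning for player 2. -/
structure IsRefutation (G : ParityGame V₁ V₂ A₁ A₂) (T : Transducer A₁ A₂ M) (x : List A₂)
    (S : Set (M × V₁)) (r : V₁ ⊕ V₂ → M × V₁ → ℕ) : Prop where
  mem : conf G T x ∈ S
  next_mem : ∀ p ∈ S, ∀ b, confNext G T p b ∈ S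
  rank_le : ∀ w, Even (G.color w) → ∀ p ∈ S, Below G T (G.color w) p →
    ∀ b, r w (confNext G T p b) ≤ r w p
  rank_lt : ∀ w, Even (G.color w) → ∀ p ∈ S, Below G T (G.color w) p →
    Hits G T (G.color w) p → ∀ b, r w (confNext G T p b) < r w p

theorem IsRefutation.foldl_mem {x : List A₂} {S : Set (M × V₁)} {r : V₁ ⊕ V₂ → M × V₁ → ℕ}
    (h : IsRefutation G T x S r) (y : List A₂) {p : M × V₁} (hp : p ∈ S) :
    y.foldl (confNext G T) p ∈ S := by
  induction y generalizing p with
  | nil => exact hp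
  | cons b y ih => exact ih (h.next_mem p hp b)

/-- A sequence of natural numbers that does not increase cannot decrease infinitely often. -/
theorem not_infinitely_often_lt {f : ℕ → ℕ} {N : ℕ} (h : ∀ i, N ≤ i → f (i + 1) ≤ f i) :
    ¬ ∀ n, ∃ i, n ≤ i ∧ f (i + 1) < f i := by
  intro h'
  have hanti : ∀ i j, N ≤ i → i ≤ j → f j ≤ f i := fun i j hi hij => by
    induction j, hij using Nat.le_induction with
    | base => exact le_rfl
    | succ j hij ih => exact (h j (hi.trans hij)).trans ih
  have key : ∀ m, ∃ i, N ≤ i ∧ f i + m ≤ f N := by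
    intro m
    induction m with
    | zero => exact ⟨N, le_rfl, le_rfl⟩
    | succ m ih =>
      obtain ⟨i, hi, hm⟩ := ih
      obtain ⟨j, hj, hlt⟩ := h' i
      have := hanti i j hi hj
      exact ⟨j + 1, by omega, by omega⟩
  obtain ⟨i, -, hi⟩ := key (f N + 1)
  omega

/-- No play that runs into the set of a refutation is winning for player 2. -/
theorem IsRefutation.not_winning [Finite V₁] [Finite V₂] {x : List A₂} {S : Set (M × V₁)}
    {r : V₁ ⊕ V₂ → M × V₁ → ℕ} (h : IsRefutation G T x S r) {b : Stream' A₂}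
    (hb : b.take x.length = x) : ¬ G.WinningForPlayer2 (inducedWord T b) := by
  rintro ⟨c, ⟨hc, hmax⟩, heven⟩
  have hc' := occursInfinitelyOften_inducedWord.1 hc
  obtain ⟨w, hw⟩ : ∃ w, G.color w = c := by
    obtain ⟨i, -, hi | hi⟩ := hc' 0
    exacts [⟨_, hi⟩, ⟨_, hi⟩]
  -- As there are only finitely many vertices, no color above `c` is visited from some time on.
  have hN : ∀ v : V₁ ⊕ V₂, ∃ N, ∀ i, N ≤ i → Hits G T (G.color v) (conf G T (b.take i)) →
      G.color v ≤ c := by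
    intro v
    by_cases hv : G.color v ≤ c
    · exact ⟨0, fun _ _ _ => hv⟩
    · by_contra! hcon
      refine hv (hmax (occursInfinitelyOften_inducedWord.2 fun N => ?_))
      obtain ⟨i, hi, hh, -⟩ := hcon N
      exact ⟨i, hi, hh⟩
  choose N hN using hN
  obtain ⟨N', hN'⟩ := (Set.finite_range N).bddAbove
  have hbelow : ∀ i, N' ≤ i → Below G T c (conf G T (b.take i)) := by
    intro i hi
    exact ⟨hN (.inl _) i ((hN' ⟨_, rfl⟩).trans hi) (.inl rfl),
      hN (.inr _) i ((hN' ⟨_, rfl⟩).trans hi) (.inr rfl)⟩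
  have hS : ∀ i, x.length ≤ i → conf G T (b.take i) ∈ S := by
    intro i hi
    obtain ⟨z, hz⟩ := take_of_take_eq hb hi
    rw [hz, conf_append]
    exact h.foldl_mem z h.mem
  have hstep : ∀ i, conf G T (b.take (i + 1)) = confNext G T (conf G T (b.take i)) (b.get i) := by
    intro i
    rw [Stream'.take_succ', conf_append]
    rfl
  subst hw
  refine not_infinitely_often_lt (f := fun i => r w (conf G T (b.take i)))
    (N := max N' x.length) (fun i hi => ?_) fun n => ?_
  · simp only [hstep]
    exact h.rank_le w heven _ (hS i (by omega)) (hbelow i (by omega)) _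
  · obtain ⟨i, hi, hh⟩ := hc' (max n (max N' x.length))
    refine ⟨i, by omega, ?_⟩
    simp only [hstep]
    exact h.rank_lt w heven _ (hS i (by omega)) (hbelow i (by omega)) hh _

/-! ### Soundness of refutations -/

/-- Any finite sequence of moves of player 2 can be extended so that all transducers with finitely
many states that have produced the same outputs as `T` so far will do so forever. The extension
minimizes the number of these transducers. -/
theorem exists_distinguishing_extension [Finite A₁] [Finite A₂] [Finite M]
    [Nonempty A₂] (T : Transducer A₁ A₂ M) (x : List A₂) :
    ∃ y, ∀ T' : Transducer A₁ A₂ M,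
      (∀ i < (x ++ y).length, T'.output ((x ++ y).take i) = T.output ((x ++ y).take i)) →
        ∀ z, T'.output (x ++ y ++ z) = T.output (x ++ y ++ z) := by
  have hfin : Finite (Transducer A₁ A₂ M) :=
    Finite.of_injective (fun T : Transducer A₁ A₂ M => (T.start, T.next, T.label)) <| by
      rintro ⟨s, n, l⟩ ⟨s', n', l'⟩ h
      simp only [Prod.mk.injEq] at h
      obtain ⟨rfl, rfl, rfl⟩ := h
      rfl
  let A : List A₂ → Set (Transducer A₁ A₂ M) := fun y =>
    {T' | ∀ i < (x ++ y).length, T'.output ((x ++ y).take i) = T.output ((x ++ y).take i)}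
  obtain ⟨y, hy⟩ : ∃ y, ∀ y', (A y).ncard ≤ (A y').ncard := by
    obtain ⟨-, ⟨y, rfl⟩, hy⟩ := WellFounded.has_min (wellFounded_lt (α := ℕ))
      (Set.range fun y => (A y).ncard) ⟨_, [], rfl⟩
    exact ⟨y, fun y' => not_lt.1 (hy _ ⟨y', rfl⟩)⟩
  obtain ⟨b⟩ := ‹Nonempty A₂›
  refine ⟨y, fun T' hT' z => ?_⟩
  by_contra hne
  -- The last letter makes the output after `x ++ y ++ z` part of the word.
  refine absurd (hy (y ++ z ++ [b])) (not_le.2 (Set.ncard_lt_ncard ?_ (Set.toFinite _)))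
  have happ : x ++ (y ++ z ++ [b]) = x ++ y ++ z ++ [b] := by simp only [List.append_assoc]
  refine (Set.ssubset_iff_of_subset fun T'' hT'' i hi => ?_).2 ⟨T', hT', fun hcon => hne ?_⟩
  · have h1 := hT'' i (by simp only [List.length_append] at *; omega)
    rwa [happ, List.append_assoc, List.take_append_of_le_length hi.le] at h1
  · have h1 := hcon (x ++ y ++ z).length (by rw [happ]; simp)
    rwa [happ, List.take_left'  rfl] at h1

theorem take_appendStream' (l : List A₂) (s : Stream' A₂) :
    (Stream'.appendStream' l s).take l.length = l := by
  induction l with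
  | nil => rfl
  | cons a l ih =>
    rw [List.length_cons, Stream'.cons_append_stream, Stream'.take_succ_cons, ih]

theorem map_snd_appendStream' (l : List (A₁ × A₂)) (s : Stream' (A₁ × A₂)) :
    (Stream'.appendStream' l s).map Prod.snd
      = Stream'.appendStream' (l.map Prod.snd) (s.map Prod.snd) := by
  induction l with
  | nil => rfl
  | cons a l ih =>
    rw [Stream'.cons_append_stream, List.map_cons, Stream'.cons_append_stream, ← ih,
      Stream'.map_cons]

end Configurations

section Soundness

variable {V₁ V₂ A₁ A₂ : Type} {G : ParityGame V₁ V₂ A₁ A₂} {k : ℕ}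
  {T : Transducer A₁ A₂ (Fin k)}

theorem agreesFin_inducedList (x : List A₂) : T.AgreesFin (inducedList T x) := by
  intro i hi
  rw [List.map_take, map_snd_inducedList]
  simp [inducedList]

/-- By extending the word of the moves `x` so that it determines all later outputs, every word
in the transducer language that extends it agrees with `T` and hence runs into `S`. -/
theorem IsRefutation.not_live [Finite V₁] [Finite V₂] [Finite A₁] [Finite A₂] {x : List A₂}
    {S : Set (Fin k × V₁)} {r : V₁ ⊕ V₂ → Fin k × V₁ → ℕ} (h : IsRefutation G T x S r) :
    ¬ IsTransducerLive k G := by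
  intro hlive
  have hne : Nonempty A₂ := by
    obtain ⟨β, -⟩ := hlive (inducedList T x) ⟨T, agreesFin_inducedList _⟩
    exact ⟨(β.get 0).2⟩
  obtain ⟨y, hy⟩ := exists_distinguishing_extension T x
  obtain ⟨β, ⟨T', hT'⟩, hwin⟩ := hlive (inducedList T (x ++ y)) ⟨T, agreesFin_inducedList _⟩
  revert hT' hwin
  generalize hw : Stream'.appendStream' (inducedList T (x ++ y)) β = w
  intro hwin hT'
  let b := w.map Prod.snd
  have htake : b.take (x ++ y).length = x ++ y := by
    have h1 := take_appendStream' (x ++ y) (β.map Prod.snd)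
    simpa only [b, ← hw, map_snd_appendStream', map_snd_inducedList] using h1
  have htake' : ∀ i ≤ (x ++ y).length, b.take i = (x ++ y).take i := by
    intro i hi
    rw [← htake, Stream'.take_take, min_eq_right hi]
  have hout : ∀ i, T'.output (b.take i) = (w.get i).1 := by
    intro i
    rw [← hT' i, map_snd_take]
  -- The outputs of `T` and `T'` agree on `x ++ y` as this word is part of `w`.
  have hlt : ∀ i < (x ++ y).length,
      T'.output ((x ++ y).take i) = T.output ((x ++ y).take i) := by
    intro i hi
    rw [← htake' i hi.le, hout, htake' i hi.le]
    have hi' : i < (inducedList T (x ++ y)).length := by rwa [length_inducedList]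
    have h1 : some (w.get i) = some ((inducedList T (x ++ y))[i]) := by
      rw [← Stream'.getElem?_take hi', ← hw, take_appendStream', List.getElem?_eq_getElem]
    rw [Option.some.inj h1]
    simp [inducedList]
  have hind : w = inducedWord T b := by
    rw [← agreesInf_iff]
    intro i
    rw [map_snd_take, ← hout i]
    rcases lt_or_ge i (x ++ y).length with hi | hi
    · rw [htake' i hi.le]
      exact (hlt i hi).symm
    · obtain ⟨z, hz⟩ := take_of_take_eq htake hi
      rw [hz]
      exact (hy T' hlt z).symm
  refine h.not_winning (b := b) ?_ (hind ▸ hwin)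
  rw [htake' _ (by simp), List.take_left' rfl]

end Soundness

/-! ### Existence of refutations -/

section Completeness

variable {V₁ V₂ A₁ A₂ M : Type} (G : ParityGame V₁ V₂ A₁ A₂) (T : Transducer A₁ A₂ M)

/-- `z` leads from `p` to `q` and all configurations before `q` only visit colors up to `c`. -/
def BelowPath (c : ℕ) (p : M × V₁) (z : List A₂) (q : M × V₁) : Prop :=
  z.foldl (confNext G T) p = q ∧ ∀ i < z.length, Below G T c ((z.take i).foldl (confNext G T) p)

variable {G T}

theorem BelowPath.cons {c : ℕ} {p q : M × V₁} {z : List A₂} {b : A₂} (hp : Below G T c p)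
    (h : BelowPath G T c (confNext G T p b) z q) : BelowPath G T c p (b :: z) q := by
  refine ⟨h.1, fun i hi => ?_⟩
  cases i with
  | zero => exact hp
  | succ i => exact h.2 i (by simpa using hi)

/-- The moves `y` of player 2 followed by the infinite repetition of the moves `z`. -/
def lasso (y z : List A₂) (hz : z ≠ []) : Stream' A₂ :=
  Stream'.appendStream' y fun i => z[i % z.length]'(Nat.mod_lt _ (List.length_pos_iff.2 hz))

theorem conf_lasso {y z : List A₂} {hz : z ≠ []} {p : M × V₁} (hy : conf G T y = p)
    (hp : z.foldl (confNext G T) p = p) (i : ℕ) :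
    conf G T ((lasso y z hz).take (y.length + i))
      = (z.take (i % z.length)).foldl (confNext G T) p := by
  have hlen : 0 < z.length := List.length_pos_iff.2 hz
  induction i with
  | zero =>
    refine (congrArg (conf G T) (take_appendStream' y _)).trans (hy.trans ?_)
    rw [Nat.zero_mod]
    rfl
  | succ i ih =>
    have hlt := Nat.mod_lt i hlen
    have hget : (lasso y z hz).get (y.length + i) = z[i % z.length] := by
      exact Stream'.get_append_right i y _
    rw [← add_assoc, Stream'.take_succ', conf_append, ih, hget, ← List.foldl_append,
      List.take_concat_get' z _ hlt]
    rcases Nat.lt_or_ge (i % z.length + 1) z.length with h | h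
    · rw [← Nat.mod_add_mod, Nat.mod_eq_of_lt h]
    · have h1 : i % z.length + 1 = z.length := by omega
      rw [← Nat.mod_add_mod, h1, Nat.mod_self, List.take_length, hp]
      rfl

/-- A cycle visiting the even color `c` but no larger one can be repeated forever to win. -/
theorem winning_lasso {y z : List A₂} {hz : z ≠ []} {c : ℕ} {p : M × V₁}
    (hy : conf G T y = p) (hp : BelowPath G T c p z p) (hhit : Hits G T c p) (hc : Even c) :
    G.WinningForPlayer2 (inducedWord T (lasso y z hz)) := by
  have hlen : 0 < z.length := List.length_pos_iff.2 hz
  refine ⟨c, ⟨occursInfinitelyOften_inducedWord.2 fun N => ?_, fun d hd => ?_⟩, hc⟩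
  · refine ⟨y.length + z.length * N, by nlinarith, ?_⟩
    rw [conf_lasso hy hp.1, Nat.mul_mod_right]
    exact hhit
  · obtain ⟨i, hi, hh⟩ := occursInfinitelyOften_inducedWord.1 hd y.length
    obtain ⟨j, rfl⟩ := Nat.exists_eq_add_of_le hi
    rw [conf_lasso hy hp.1] at hh
    exact (hp.2 _ (Nat.mod_lt _ hlen)).le_of_hits hh

/-- Every reachable configuration is reached by at most as many moves as there are
configurations. -/
theorem exists_short_path [Finite M] [Finite V₁] (x : List A₂) :
    ∃ y : List A₂, conf G T y = conf G T x ∧ y.length ≤ Nat.card (M × V₁) := by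
  obtain ⟨-, ⟨y, hy, rfl⟩, hmin⟩ := WellFounded.has_min (wellFounded_lt (α := ℕ))
    (List.length '' {y | conf G T y = conf G T x}) ⟨_, x, rfl, rfl⟩
  refine ⟨y, hy, ?_⟩
  by_contra! hlt
  have hcard : Nat.card (M × V₁) < Nat.card (Fin y.length) := by simpa using hlt
  have hninj : ¬ Function.Injective fun i : Fin y.length => conf G T (y.take i) :=
    fun hinj => absurd (Nat.card_le_card_of_injective _ hinj) (not_le.2 hcard)
  obtain ⟨i, j, hij, hne⟩ := Function.not_injective_iff.1 hninj
  wlog hlt' : i < j generalizing i j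
  · exact this j i hij.symm hne.symm (lt_of_le_of_ne (not_lt.1 hlt') hne.symm)
  -- The part of the path between two equal configurations can be removed.
  refine hmin (y.take i ++ y.drop j).length ⟨_, ?_, rfl⟩ ?_
  · have h1 : conf G T (y.take j ++ y.drop j) = conf G T x := by rw [List.take_append_drop, hy]
    rw [conf_append] at h1
    exact (conf_append G T _ _).trans
      ((congrArg (fun p => (y.drop j).foldl (confNext G T) p) hij).trans h1)
  · simp only [List.length_append, List.length_take, List.length_drop]
    have := j.2
    have : (i : ℕ) < j := hlt'
    omega

open Classical in
/-- If no play through the configuration reached by the moves `x` is winning for player 2, there is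
a refutation. The set consists of all configurations reachable from this one; the rank of `p` is the
number of configurations visiting the color that are reachable from `p` below this color. -/
theorem exists_isRefutation [Finite M] [Finite V₁] (x : List A₂)
    (h : ∀ b : Stream' A₂, b.take x.length = x → ¬ G.WinningForPlayer2 (inducedWord T b)) :
    ∃ y S r, IsRefutation G T y S r ∧ y.length ≤ Nat.card (M × V₁) ∧
      ∀ w p, r w p ≤ Nat.card (M × V₁) := by
  obtain ⟨y, hy, hlen⟩ := exists_short_path (G := G) (T := T) x
  let R : V₁ ⊕ V₂ → M × V₁ → Set (M × V₁) := fun w p =>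
    {q | (∃ z, BelowPath G T (G.color w) p z q) ∧ Below G T (G.color w) q ∧
      Hits G T (G.color w) q}
  have hsub : ∀ w p b, Below G T (G.color w) p → R w (confNext G T p b) ⊆ R w p := by
    rintro w p b hp q ⟨⟨z, hz⟩, hq⟩
    exact ⟨⟨b :: z, hz.cons hp⟩, hq⟩
  refine ⟨y, {p | ∃ z : List A₂, z.foldl (confNext G T) (conf G T x) = p},
    fun w p => (R w p).ncard, ⟨⟨[], hy.symm⟩, ?_, ?_, ?_⟩, hlen, fun w p => Set.ncard_le_card _⟩
  · rintro _ ⟨z, rfl⟩ b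
    exact ⟨z ++ [b], by rw [List.foldl_append]; rfl⟩
  · exact fun w _ p _ hp b => Set.ncard_le_ncard (hsub w p b hp) (Set.toFinite _)
  · rintro w heven p ⟨z, hz⟩ hp hhit b
    refine Set.ncard_lt_ncard ((Set.ssubset_iff_of_subset (hsub w p b hp)).2
      ⟨p, ⟨⟨[], rfl, fun i hi => absurd hi (by simp)⟩, hp, hhit⟩, ?_⟩) (Set.toFinite _)
    rintro ⟨⟨z', hz'⟩, -⟩
    -- Otherwise there is a cycle on which `G.color w` is the largest color.
    refine h (lasso (x ++ z) (b :: z') (List.cons_ne_nil _ _)) ?_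
      (winning_lasso (p := p) ((conf_append ..).trans hz) (hz'.cons hp) hhit heven)
    have h1 := take_appendStream' (x ++ z) (fun i => (b :: z')[i % (b :: z').length]'
      (Nat.mod_lt _ (by simp)))
    have h2 := congrArg (List.take x.length) h1
    rwa [Stream'.take_take, List.take_left' rfl, min_eq_right (by simp)] at h2

/-- If `α` has no extension in the transducer language and agrees with `T`, in particular no
extension of `α` that agrees with `T` is winning. -/
theorem exists_isRefutation_of_not_live [Finite V₁] {k : ℕ} (h : ¬ IsTransducerLive k G) :
    ∃ (T : Transducer A₁ A₂ (Fin k)) (y : List A₂) (S : Set (Fin k × V₁))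
      (r : V₁ ⊕ V₂ → Fin k × V₁ → ℕ), IsRefutation G T y S r ∧
      y.length ≤ Nat.card (Fin k × V₁) ∧ ∀ w p, r w p ≤ Nat.card (Fin k × V₁) := by
  unfold IsTransducerLive at h
  push Not at h
  obtain ⟨α, ⟨T, hT⟩, hα⟩ := h
  refine ⟨T, exists_isRefutation (α.map Prod.snd) fun b hb hwin => ?_⟩
  refine hα ((inducedWord T b).drop α.length) ?_
  have hword : Stream'.appendStream' α ((inducedWord T b).drop α.length) = inducedWord T b := by
    have h1 := Stream'.append_take_drop α.length (inducedWord T b)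
    rw [List.length_map] at hb
    have h2 : (inducedWord T b).take α.length = α := by
      refine List.ext_getElem (Stream'.length_take _ _) fun i hi hi' => ?_
      have h3 : ((inducedWord T b).take α.length)[i] = (inducedWord T b).get i := by
        apply Option.some.inj
        rw [← List.getElem?_eq_getElem, Stream'.getElem?_take hi']
      rw [h3]
      have h4 : b.take i = (α.take i).map Prod.snd := by
        rw [List.map_take, ← hb, Stream'.take_take, min_eq_right hi'.le]
      have h5 : b.get i = (α[i]).2 := by
        apply Option.some.inj
        rw [← Stream'.getElem?_take hi', hb, List.getElem?_map, List.getElem?_eq_getElem hi']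
        rfl
      refine Prod.ext ?_ h5
      change T.output (b.take i) = _
      rw [h4]
      exact hT i hi'
    rwa [h2] at h1
  rw [hword]
  exact ⟨⟨T, agreesInf_inducedWord T b⟩, hwin⟩

end Completeness

/-! ### Binary digits -/

/-- The number with the given binary digits, least significant digit first. -/
def ofBits (l : List Bool) : ℕ := l.foldr (fun b v => 2 * v + b.toNat) 0

theorem ofBits_cons (b : Bool) (l : List Bool) : ofBits (b :: l) = 2 * ofBits l + b.toNat := rfl

theorem ofBits_encodeNat (n : ℕ) : ofBits (Computability.encodeNat n) = n := by
  have hpos : ∀ p : PosNum, ofBits (Computability.encodePosNum p) = p := by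
    intro p
    induction p with
    | one => rfl
    | bit1 p ih =>
      rw [Computability.encodePosNum, ofBits_cons, ih, PosNum.cast_bit1, Bool.toNat_true]
      simp; omega
    | bit0 p ih =>
      rw [Computability.encodePosNum, ofBits_cons, ih, PosNum.cast_bit0, Bool.toNat_false]
      simp; omega
  unfold Computability.encodeNat
  conv_rhs => rw [← Num.to_of_nat n]
  cases (n : Num) with
  | zero => rfl
  | pos p => exact hpos p

theorem bitsValue_eq (N : ℕ) (l : List Bool) : bitsValue N l = min N (ofBits l) := by
  induction l with
  | nil => simp [bitsValue, ofBits]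
  | cons b l ih =>
    have h : bitsValue N (b :: l) = min N (2 * bitsValue N l + bif b then 1 else 0) := rfl
    rw [h, ih, ofBits_cons]
    cases b <;> simp <;> omega

theorem testBit_ofBits (l : List Bool) (i : ℕ) : (ofBits l).testBit i = l.getD i false := by
  induction l generalizing i with
  | nil => simp [ofBits]
  | cons b l ih =>
    rw [ofBits_cons]
    cases i with
    | zero => cases b <;> simp [Nat.testBit_zero]
    | succ i =>
      rw [List.getD_cons_succ, ← ih, Nat.testBit_succ]
      congr 1
      cases b
      · simp
      · simp; omega

theorem ofBits_lt (l : List Bool) : ofBits l < 2 ^ l.length := by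
  induction l with
  | nil => simp [ofBits]
  | cons b l ih =>
    rw [ofBits_cons, List.length_cons, pow_succ]
    have := b.toNat_le
    omega

theorem mod_two_pow_add_one (x n : ℕ) :
    x % 2 ^ (n + 1) = x % 2 ^ n + 2 ^ n * (x.testBit n).toNat := by
  rw [Nat.mod_pow_succ, Nat.testBit_eq_decide_div_mod_eq]
  rcases Nat.mod_two_eq_zero_or_one (x / 2 ^ n) with h | h <;> simp [h]

theorem leBits_eq (a b : List Bool) : leBits a b = decide (ofBits a ≤ ofBits b) := by
  have key : ∀ n : ℕ, (n.rec true fun i r =>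
      bif a.getD i false then b.getD i false && r else b.getD i false || r : Bool)
        = decide (ofBits a % 2 ^ n ≤ ofBits b % 2 ^ n) := by
    intro n
    induction n with
    | zero => simp [Nat.mod_one]
    | succ n ih =>
      simp only [ih, mod_two_pow_add_one, testBit_ofBits]
      have ha := Nat.mod_lt (ofBits a) (Nat.two_pow_pos n)
      have hb := Nat.mod_lt (ofBits b) (Nat.two_pow_pos n)
      cases a.getD n false <;> cases b.getD n false <;> simp <;> omega
  have ha : ofBits a < 2 ^ (a.length + b.length) :=
    (ofBits_lt a).trans_le (Nat.pow_le_pow_right (by omega) (by omega))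
  have hb : ofBits b < 2 ^ (a.length + b.length) :=
    (ofBits_lt b).trans_le (Nat.pow_le_pow_right (by omega) (by omega))
  have h := key (a.length + b.length)
  rw [Nat.mod_eq_of_lt ha, Nat.mod_eq_of_lt hb] at h
  exact h

theorem leBits_encodeNat (m n : ℕ) :
    leBits (Computability.encodeNat m) (Computability.encodeNat n) = decide (m ≤ n) := by
  rw [leBits_eq, ofBits_encodeNat, ofBits_encodeNat]

theorem getD_encodeNat_zero (n : ℕ) :
    (Computability.encodeNat n).getD 0 false = !decide (Even n) := by
  rw [← testBit_ofBits, ofBits_encodeNat, Nat.testBit_zero]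
  rcases Nat.mod_two_eq_zero_or_one n with h | h <;> simp [h, Nat.even_iff]

/-! ### Parsing encoded instances -/

/-- The numbers in a certificate. -/
def certNumbers (y : List Bool) : List ℕ := ((y.map Sum.inr).foldr parseLetter ([], [])).2

theorem foldr_parseLetter_certificate (y : List Bool) :
    (y.map Sum.inr).foldr parseLetter ([], []) = ([], certNumbers y) := by
  refine Prod.ext ?_ rfl
  induction y with
  | nil => rfl
  | cons b y ih => exact ih

/-- The certificate with the given numbers. -/
def certOfNumbers (c : List ℕ) : List Bool := c.flatMap fun n => List.replicate n true ++ [false]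

theorem certNumbers_certOfNumbers (c : List ℕ) : certNumbers (certOfNumbers c) = c := by
  induction c with
  | nil => rfl
  | cons n c ih =>
    have h : ∀ y, certNumbers (List.replicate n true ++ false :: y) = n :: certNumbers y := by
      intro y
      induction n with
      | zero => rfl
      | succ n ih' =>
        have h' : ∀ z, certNumbers (true :: z)
            = ((certNumbers z).getD 0 0 + 1) :: (certNumbers z).tail := fun z => rfl
        rw [List.replicate_succ, List.cons_append, h', ih']
        rfl
    have h1 : certOfNumbers (n :: c) = List.replicate n true ++ false :: certOfNumbers c := by
      simp [certOfNumbers]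
    rw [h1, h, ih]

theorem length_certOfNumbers_le {c : List ℕ} {V : ℕ} (h : ∀ n ∈ c, n ≤ V) :
    (certOfNumbers c).length ≤ c.length * (V + 1) := by
  induction c with
  | nil => simp [certOfNumbers]
  | cons n c ih =>
    have h1 := ih fun m hm => h m (List.mem_cons_of_mem _ hm)
    have h2 := h n List.mem_cons_self
    simp only [certOfNumbers, List.flatMap_cons, List.length_append, List.length_replicate,
      List.length_cons, List.length_nil] at *
    rw [Nat.add_mul]
    omega

theorem foldr_parseLetter_word (l : List Bool) (p : List (List Bool) × List ℕ) :
    ((l.map some ++ [none]).map Sum.inl).foldr parseLetter p = (l :: p.1, p.2) := by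
  induction l with
  | nil => rfl
  | cons b l ih =>
    rw [List.map_cons, List.cons_append, List.map_cons, List.foldr_cons, ih]
    rfl

theorem foldr_parseLetter_words (L : List (List Bool)) (p : List (List Bool) × List ℕ) :
    ((L.flatMap fun l => l.map some ++ [none]).map Sum.inl).foldr parseLetter p
      = (L ++ p.1, p.2) := by
  induction L with
  | nil => rfl
  | cons l L ih =>
    rw [List.flatMap_cons, List.map_append, List.foldr_append, ih, foldr_parseLetter_word]
    rfl

/-- Parsing recovers the unary number and the binary numbers of an encoded instance. -/
theorem parseInput_encode (I : LivenessInstance) (y : List Bool) :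
    parseInput (encodeWithCertificate LivenessInstance.encode (I, y))
      = (I.encode.length + y.length,
        List.replicate I.k true :: I.gameData.map Computability.encodeNat, certNumbers y) := by
  have h : I.encode = (List.replicate I.k true :: I.gameData.map Computability.encodeNat).flatMap
      fun l => l.map some ++ [none] := by
    simp [LivenessInstance.encode, List.flatMap_map]
  refine Prod.ext (by simp [parseInput, encodeWithCertificate]) ?_
  simp only [parseInput, encodeWithCertificate]
  rw [List.foldr_append, foldr_parseLetter_certificate, h, foldr_parseLetter_words]
  simp

/-! ### Tables -/

theorem length_flatMap_of_length_eq {α β : Type} {m : ℕ} {g : α → List β}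
    (hg : ∀ a, (g a).length = m) (L : List α) : (L.flatMap g).length = L.length * m := by
  induction L with
  | nil => simp
  | cons a L ih => rw [List.flatMap_cons, List.length_append, ih, hg, List.length_cons]; ring

theorem getElem?_flatMap_of_length_eq {α β : Type} {m : ℕ} {g : α → List β}
    (hg : ∀ a, (g a).length = m) (L : List α) {i j : ℕ} (hi : i < L.length) (hj : j < m) :
    (L.flatMap g)[i * m + j]? = (g L[i])[j]? := by
  induction L generalizing i with
  | nil => simp at hi
  | cons a L ih =>
    rw [List.flatMap_cons]
    cases i with
    | zero => rw [List.getElem?_append_left (by rw [hg]; omega)]; simp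
    | succ i =>
      rw [List.getElem?_append_right (by rw [hg, Nat.add_mul]; omega), hg,
        show (i + 1) * m + j - m = i * m + j by rw [Nat.add_mul]; omega,
        ih (by simpa using hi)]
      rfl

theorem getElem?_table {n m : ℕ} (f : Fin n → Fin m → ℕ) (u : Fin n) (a : Fin m) :
    ((List.finRange n).flatMap fun u => (List.finRange m).map (f u))[u * m + a]?
      = some (f u a) := by
  rw [getElem?_flatMap_of_length_eq (m := m) (fun _ => by simp) _ (by simp) a.2]
  simp

namespace LivenessInstance

variable (I : LivenessInstance)

/-- The position of a vertex in the list of all vertices. -/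
def vertexIndex : Fin I.n₁ ⊕ Fin I.n₂ → ℕ := Sum.elim (fun u => u) fun v => I.n₁ + v

theorem length_gameData :
    I.gameData.length = 5 + I.n₁ * I.m₁ + I.n₂ * I.m₂ + I.n₁ + I.n₂ := by
  simp only [gameData, List.length_append]
  rw [length_flatMap_of_length_eq (m := I.m₁) (fun _ => by simp),
    length_flatMap_of_length_eq (m := I.m₂) (fun _ => by simp)]
  simp

theorem getElem?_gameData_tgt₁ (u : Fin I.n₁) (a : Fin I.m₁) :
    I.gameData[5 + (u * I.m₁ + a)]? = some ((I.game.E₁ u a : Fin I.n₂) : ℕ) := by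
  have hlen := length_flatMap_of_length_eq (m := I.m₁)
    (g := fun u => (List.finRange I.m₁).map (fun a => (I.game.E₁ u a : ℕ))) (fun _ => by simp)
    (List.finRange I.n₁)
  rw [List.length_finRange] at hlen
  have h := getElem?_table (fun u a => (I.game.E₁ u a : ℕ)) u a
  have hlt := (List.getElem?_eq_some_iff.1 h).1
  simp only [gameData, List.append_assoc]
  rw [List.getElem?_append_right (by simp), List.getElem?_append_left (by simpa using hlt)]
  simpa using h

theorem getElem?_gameData_tgt₂ (v : Fin I.n₂) (b : Fin I.m₂) :
    I.gameData[5 + I.n₁ * I.m₁ + (v * I.m₂ + b)]? = some ((I.game.E₂ v b : Fin I.n₁) : ℕ) := by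
  have hlen := length_flatMap_of_length_eq (m := I.m₁)
    (g := fun u => (List.finRange I.m₁).map (fun a => (I.game.E₁ u a : ℕ))) (fun _ => by simp)
    (List.finRange I.n₁)
  rw [List.length_finRange] at hlen
  have h := getElem?_table (fun v b => (I.game.E₂ v b : ℕ)) v b
  have hlt := (List.getElem?_eq_some_iff.1 h).1
  simp only [gameData, List.append_assoc]
  rw [List.getElem?_append_right (by simp; omega),
    List.getElem?_append_right (by rw [hlen]; simp; omega), hlen]
  have e : 5 + I.n₁ * I.m₁ + (v * I.m₂ + b) - [I.n₁, I.n₂, I.m₁, I.m₂, (I.game.init : ℕ)].length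
      - I.n₁ * I.m₁ = v * I.m₂ + b := by simp; omega
  rw [e, List.getElem?_append_left hlt, h]

theorem getElem?_gameData_color (w : Fin I.n₁ ⊕ Fin I.n₂) :
    I.gameData[5 + I.n₁ * I.m₁ + I.n₂ * I.m₂ + I.vertexIndex w]? = some (I.game.color w) := by
  have h1 := length_flatMap_of_length_eq (m := I.m₁)
    (g := fun u => (List.finRange I.m₁).map (fun a => (I.game.E₁ u a : ℕ))) (fun _ => by simp)
    (List.finRange I.n₁)
  have h2 := length_flatMap_of_length_eq (m := I.m₂)
    (g := fun v => (List.finRange I.m₂).map (fun b => (I.game.E₂ v b : ℕ))) (fun _ => by simp)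
    (List.finRange I.n₂)
  rw [List.length_finRange] at h1 h2
  rw [gameData, List.append_assoc, List.getElem?_append_right]
  · simp only [List.length_append, h1, h2]
    rw [show 5 + I.n₁ * I.m₁ + I.n₂ * I.m₂ + I.vertexIndex w -
      ([I.n₁, I.n₂, I.m₁, I.m₂, (I.game.init : ℕ)].length + I.n₁ * I.m₁ + I.n₂ * I.m₂)
        = I.vertexIndex w by simp]
    rcases w with u | v
    · rw [vertexIndex, Sum.elim_inl, List.getElem?_append_left (by simp)]
      simp
    · rw [vertexIndex, Sum.elim_inr, List.getElem?_append_right (by simp)]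
      simp
  · simp only [List.length_append, h1, h2]
    simp

theorem length_gameData_le_length_encode : I.gameData.length ≤ I.encode.length := by
  have h : ∀ L : List ℕ,
      L.length ≤ (L.flatMap fun n => (Computability.encodeNat n).map some ++ [none]).length := by
    intro L
    induction L with
    | nil => simp
    | cons n L ih =>
      rw [List.flatMap_cons, List.length_append, List.length_append, List.length_cons]
      simp only [List.length_cons]
      omega
  rw [encode, List.length_append]
  exact (h _).trans (Nat.le_add_left _ _)

theorem k_le_length_encode : I.k ≤ I.encode.length := by
  simp only [encode, List.length_append, List.length_replicate]
  omega

end LivenessInstance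

/-! ### What the verifier checks -/

/-- The parsed input `e` describes the instance `I` without loss by capping. -/
structure Describes (e : Parsed) (I : LivenessInstance) : Prop where
  numStates : e.numStates = I.k
  n₁ : e.num 0 = I.n₁
  n₂ : e.num 1 = I.n₂
  m₁ : e.num 2 = I.m₁
  m₂ : e.num 3 = I.m₂
  init : e.num 4 = I.game.init
  tgt₁ : ∀ (u : Fin I.n₁) (a : Fin I.m₁), e.tgt₁ u a = I.game.E₁ u a
  tgt₂ : ∀ (v : Fin I.n₂) (b : Fin I.m₂), e.tgt₂ v b = I.game.E₂ v b
  color : ∀ w, e.colorBits (I.vertexIndex w) = Computability.encodeNat (I.game.color w)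

/-- If player 1 has an action, all numbers that describe the game, except for its colors, are
bounded by the length of the encoding, so that capping does not change them. Without actions of
player 1 there need not be any vertex of player 2, and `m₂` may be exponentially large. -/
theorem describes_of_pos {I : LivenessInstance} (h : 0 < I.m₁) {N : ℕ}
    (hN : I.encode.length ≤ N) (c : List ℕ) :
    Describes (N, List.replicate I.k true :: I.gameData.map Computability.encodeNat, c) I := by
  set e : Parsed := (N, List.replicate I.k true :: I.gameData.map Computability.encodeNat, c)
    with he
  have hn₁ : 0 < I.n₁ := I.game.init.pos
  have hn₂ : 0 < I.n₂ := (I.game.E₁ I.game.init ⟨0, h⟩).pos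
  have hlen := I.length_gameData
  have hle := I.length_gameData_le_length_encode
  have hm₁ : I.m₁ ≤ I.n₁ * I.m₁ := Nat.le_mul_of_pos_left _ hn₁
  have hm₂ : I.m₂ ≤ I.n₂ * I.m₂ := Nat.le_mul_of_pos_left _ hn₂
  have hnum : ∀ j n, I.gameData[j]? = some n → n ≤ N → e.num j = n := by
    intro j n hj hn
    simp only [Parsed.num, he, List.getD_eq_getElem?_getD, List.getElem?_cons_succ,
      List.getElem?_map, hj, Option.map_some, Option.getD_some, bitsValue_eq, ofBits_encodeNat]
    exact min_eq_right hn
  have h0 : e.num 0 = I.n₁ := hnum _ _ rfl (by omega)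
  have h1 : e.num 1 = I.n₂ := hnum _ _ rfl (by omega)
  have h2 : e.num 2 = I.m₁ := hnum _ _ rfl (by omega)
  have h3 : e.num 3 = I.m₂ := hnum _ _ rfl (by omega)
  have h4 : e.num 4 = I.game.init := hnum _ _ rfl (by omega)
  refine ⟨by simp [Parsed.numStates, he], h0, h1, h2, h3, h4, fun u a => ?_, fun v b => ?_,
    fun w => ?_⟩
  · rw [Parsed.tgt₁, h2]
    exact hnum _ _ (I.getElem?_gameData_tgt₁ u a) (by omega)
  · rw [Parsed.tgt₂, h0, h2, h3]
    exact hnum _ _ (I.getElem?_gameData_tgt₂ v b) (by omega)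
  · rw [Parsed.colorBits, h0, h1, h2, h3]
    have hw := I.getElem?_gameData_color w
    simp only [he, List.getD_eq_getElem?_getD, List.getElem?_cons_succ, List.getElem?_map, hw,
      Option.map_some, Option.getD_some]

section Describes

variable {e : Parsed} {I : LivenessInstance}

/-- A configuration as a pair of numbers, the form in which the verifier handles it. -/
def confVal {k n : ℕ} (p : Fin k × Fin n) : ℕ × ℕ := (p.1, p.2)

variable {T : Transducer (Fin I.m₁) (Fin I.m₂) (Fin I.k)}

/-- The certificate of `e` contains the transducer `T`. -/
structure CertifiesTransducer (e : Parsed) (I : LivenessInstance)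
    (T : Transducer (Fin I.m₁) (Fin I.m₂) (Fin I.k)) : Prop where
  start : e.certStart = T.start
  label : ∀ m : Fin I.k, e.certLabel m = T.label m
  next : ∀ (m : Fin I.k) (b : Fin I.m₂), e.certNext m b = T.next m b

theorem mid_confVal (h : Describes e I) (hT : CertifiesTransducer e I T)
    (p : Fin I.k × Fin I.n₁) : e.mid (confVal p) = midVertex I.game T p := by
  simp only [Parsed.mid, confVal, hT.label, h.tgt₁, midVertex]

theorem next_confVal (h : Describes e I) (hT : CertifiesTransducer e I T)
    (p : Fin I.k × Fin I.n₁) (b : Fin I.m₂) :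
    e.next (confVal p) b = confVal (confNext I.game T p b) := by
  rw [Parsed.next, mid_confVal h hT, h.tgt₂]
  simp only [confVal, hT.next, confNext]

theorem leBits_colorBits (h : Describes e I) (w w' : Fin I.n₁ ⊕ Fin I.n₂) :
    leBits (e.colorBits (I.vertexIndex w)) (e.colorBits (I.vertexIndex w'))
      = decide (I.game.color w ≤ I.game.color w') := by
  rw [h.color, h.color, leBits_encodeNat]

open Classical in
/-- The meaning of the condition on ranks. -/
theorem checkRank_iff (h : Describes e I) (hT : CertifiesTransducer e I T)
    (w : Fin I.n₁ ⊕ Fin I.n₂) (p : Fin I.k × Fin I.n₁) :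
    e.checkRank (I.vertexIndex w) p.1 p.2 = true ↔
      (0 < e.certMem p.1 p.2 → Below I.game T (I.game.color w) p → ∀ b,
        e.certRank (I.vertexIndex w) (confNext I.game T p b).1 (confNext I.game T p b).2
          + (if Hits I.game T (I.game.color w) p then 1 else 0)
            ≤ e.certRank (I.vertexIndex w) p.1 p.2) := by
  have hu : (p.2 : ℕ) = I.vertexIndex (.inl p.2) := rfl
  have hv : e.num 0 + e.mid (confVal p) = I.vertexIndex (.inr (midVertex I.game T p)) := by
    rw [mid_confVal h hT, h.n₁]; rfl
  have hnext : ∀ b : Fin I.m₂, e.next ((p.1 : ℕ), (p.2 : ℕ)) b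
      = confVal (confNext I.game T p b) := fun b => next_confVal h hT p b
  have hforall : ∀ P : ℕ → Bool, forallLT (e.num 3) P = true ↔ ∀ b : Fin I.m₂, P b = true := by
    intro P
    rw [forallLT_eq_true, h.m₂]
    exact ⟨fun h b => h b b.2, fun h i hi => h ⟨i, hi⟩⟩
  have hlu := leBits_colorBits h (.inl p.2) w
  have hul := leBits_colorBits h w (.inl p.2)
  have hlv := leBits_colorBits h (.inr (midVertex I.game T p)) w
  have hvl := leBits_colorBits h w (.inr (midVertex I.game T p))
  rw [← hu] at hlu hul
  rw [← hv] at hlv hvl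
  simp only [confVal] at hlv hvl hnext
  simp only [Parsed.checkRank, hlu, hul, hlv, hvl, Bool.or_eq_true, Bool.not_eq_true',
    decide_eq_false_iff_not, hforall, hnext, decide_eq_true_eq, Bool.cond_eq_ite]
  rw [← imp_iff_not_or, ← imp_iff_not_or, ← imp_iff_not_or]
  unfold Below
  rw [and_imp]
  refine imp_congr_right fun _ => imp_congr_right fun hbu => imp_congr_right fun hbv =>
    forall_congr' fun b => ?_
  have hhit : (I.game.color w ≤ I.game.color (.inl p.2) ∨
      I.game.color w ≤ I.game.color (.inr (midVertex I.game T p)))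
        ↔ Hits I.game T (I.game.color w) p := by
    unfold Hits
    omega
  simp only [hhit, Nat.lt_succ_iff]

theorem vertexIndex_lt (w : Fin I.n₁ ⊕ Fin I.n₂) : I.vertexIndex w < I.n₁ + I.n₂ := by
  rcases w with u | v
  · exact u.2.trans_le (Nat.le_add_right _ _)
  · exact Nat.add_lt_add_left v.2 _

theorem exists_vertexIndex_eq {j : ℕ} (hj : j < I.n₁ + I.n₂) : ∃ w, I.vertexIndex w = j := by
  rcases lt_or_ge j I.n₁ with h | h
  · exact ⟨.inl ⟨j, h⟩, rfl⟩
  · exact ⟨.inr ⟨j - I.n₁, by omega⟩, by simp [LivenessInstance.vertexIndex]; omega⟩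

theorem vertexIndex_injective : Function.Injective I.vertexIndex := by
  rintro (u | u) (v | v) h <;> simp only [LivenessInstance.vertexIndex, Sum.elim_inl,
    Sum.elim_inr] at h
  · rw [Fin.ext h]
  · omega
  · omega
  · rw [Fin.ext (Nat.add_left_cancel h)]

theorem checkRanks_iff (h : Describes e I) :
    e.checkRanks = true ↔ ∀ w, Even (I.game.color w) → ∀ p : Fin I.k × Fin I.n₁,
      e.checkRank (I.vertexIndex w) p.1 p.2 = true := by
  simp only [Parsed.checkRanks, forallLT_eq_true, h.n₁, h.n₂, h.numStates, Bool.or_eq_true]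
  constructor
  · intro hr w hw p
    rcases hr _ (vertexIndex_lt w) with h1 | h1
    · rw [h.color, getD_encodeNat_zero] at h1
      simp [hw] at h1
    · exact h1 p.1 p.1.2 p.2 p.2.2
  · intro hr j hj
    obtain ⟨w, rfl⟩ := exists_vertexIndex_eq hj
    by_cases hw : Even (I.game.color w)
    · exact .inr fun m hm u hu => hr w hw (⟨m, hm⟩, ⟨u, hu⟩)
    · left
      rw [h.color, getD_encodeNat_zero]
      simp [hw]

theorem checkClosed_iff (h : Describes e I) (hT : CertifiesTransducer e I T) :
    e.checkClosed = true ↔ 0 < e.certMem e.target.1 e.target.2 ∧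
      ∀ p : Fin I.k × Fin I.n₁, 0 < e.certMem p.1 p.2 → ∀ b,
        0 < e.certMem (confNext I.game T p b).1 (confNext I.game T p b).2 := by
  simp only [Parsed.checkClosed, forallLT_eq_true, h.n₁, h.numStates, h.m₂, Bool.or_eq_true,
    Bool.and_eq_true, decide_eq_true_eq, Bool.not_eq_true', decide_eq_false_iff_not,
    ← imp_iff_not_or]
  refine and_congr_right fun _ => ⟨fun hc p hp b => ?_, fun hc m hm u hu hp b hb => ?_⟩
  · have h1 := hc p.1 p.1.2 p.2 p.2.2 hp b b.2
    rwa [show ((p.1 : ℕ), (p.2 : ℕ)) = confVal p from rfl, next_confVal h hT] at h1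
  · have h1 := hc (⟨m, hm⟩, ⟨u, hu⟩) hp ⟨b, hb⟩
    rwa [show (m, u) = confVal ((⟨m, hm⟩, ⟨u, hu⟩) : Fin I.k × Fin I.n₁) from rfl,
      show b = ((⟨b, hb⟩ : Fin I.m₂) : ℕ) from rfl, next_confVal h hT]

theorem pathStep_confVal (h : Describes e I) (hT : CertifiesTransducer e I T) (i : ℕ)
    (x : List (Fin I.m₂)) :
    ∃ y, e.pathStep i (confVal (conf I.game T x)) = confVal (conf I.game T y) := by
  unfold Parsed.pathStep
  rw [h.m₂]
  by_cases hb : e.certPath i - 1 < I.m₂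
  · cases decide (0 < e.certPath i)
    · exact ⟨x, by simp⟩
    · refine ⟨x ++ [⟨_, hb⟩], ?_⟩
      rw [conf_append]
      simpa [hb] using next_confVal h hT (conf I.game T x) ⟨_, hb⟩
  · exact ⟨x, by simp [hb]⟩

theorem target_eq (h : Describes e I) (hT : CertifiesTransducer e I T) :
    ∃ x, e.target = confVal (conf I.game T x) := by
  unfold Parsed.target
  induction e.2.2.length with
  | zero => exact ⟨[], by simp [hT.start, h.init, confVal, conf]⟩
  | succ n ih =>
    obtain ⟨x, hx⟩ := ih
    obtain ⟨y, hy⟩ := pathStep_confVal h hT n x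
    exact ⟨y, by simpa only [hx] using hy⟩

/-- An accepted certificate yields a refutation of liveness. -/
theorem not_live_of_accepts (h : Describes e I) (he : e.accepts = true) : ¬ I.IsLive := by
  simp only [Parsed.accepts, Bool.and_eq_true] at he
  obtain ⟨htrans, hclosed, hranks⟩ := he
  simp only [Parsed.checkTransducer, Bool.and_eq_true, decide_eq_true_eq, forallLT_eq_true,
    h.numStates, h.m₁, h.m₂] at htrans
  obtain ⟨hstart, htrans⟩ := htrans
  let T : Transducer (Fin I.m₁) (Fin I.m₂) (Fin I.k) :=
    { start := ⟨e.certStart, hstart⟩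
      next := fun m b => ⟨e.certNext m b, (htrans m m.2).2 b b.2⟩
      label := fun m => ⟨e.certLabel m, (htrans m m.2).1⟩ }
  have hT : CertifiesTransducer e I T := ⟨rfl, fun _ => rfl, fun _ _ => rfl⟩
  obtain ⟨hmem, hnext⟩ := (checkClosed_iff h hT).1 hclosed
  have hrank := fun w hw p => (checkRank_iff h hT w p).1 ((checkRanks_iff h).1 hranks w hw p)
  obtain ⟨x, hx⟩ := target_eq h hT
  rw [hx] at hmem
  refine IsRefutation.not_live (G := I.game) (T := T) (x := x)
    (S := {p | 0 < e.certMem p.1 p.2})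
    (r := fun w p => e.certRank (I.vertexIndex w) p.1 p.2)
    ⟨hmem, hnext, fun w hw p hp hb b => ?_, fun w hw p hp hb hh b => ?_⟩
  · exact (Nat.le_add_right _ _).trans (hrank w hw p hp hb b)
  · have h1 := hrank w hw p hp hb b
    rw [if_pos hh] at h1
    exact h1

/-- The certificate of `e` contains the refutation given by `T`, `x`, `S` and `r`. -/
structure CertifiesRefutation (e : Parsed) (I : LivenessInstance)
    (T : Transducer (Fin I.m₁) (Fin I.m₂) (Fin I.k)) (x : List (Fin I.m₂))
    (S : Set (Fin I.k × Fin I.n₁)) (r : Fin I.n₁ ⊕ Fin I.n₂ → Fin I.k × Fin I.n₁ → ℕ) : Prop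
    extends CertifiesTransducer e I T where
  path : ∀ i, e.certPath i = x[i]?.elim 0 fun b => (b : ℕ) + 1
  length : x.length ≤ e.2.2.length
  mem : ∀ p : Fin I.k × Fin I.n₁, 0 < e.certMem p.1 p.2 ↔ p ∈ S
  rank : ∀ w (p : Fin I.k × Fin I.n₁), e.certRank (I.vertexIndex w) p.1 p.2 = r w p

theorem target_eq_conf {x : List (Fin I.m₂)} {S : Set (Fin I.k × Fin I.n₁)}
    {r : Fin I.n₁ ⊕ Fin I.n₂ → Fin I.k × Fin I.n₁ → ℕ} (h : Describes e I)
    (hc : CertifiesRefutation e I T x S r) : e.target = confVal (conf I.game T x) := by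
  have key : ∀ n : ℕ, (n.rec (e.certStart, e.num 4) e.pathStep : ℕ × ℕ)
      = confVal (conf I.game T (x.take n)) := by
    intro n
    induction n with
    | zero => simp [hc.start, h.init, confVal, conf]
    | succ n ih =>
      simp only [ih, Parsed.pathStep, hc.path, h.m₂]
      rcases lt_or_ge n x.length with hn | hn
      · rw [List.getElem?_eq_getElem hn, ← List.take_concat_get' x n hn, conf_append]
        simpa using next_confVal h hc.toCertifiesTransducer _ x[n]
      · rw [List.getElem?_eq_none hn, List.take_of_length_le hn,
          List.take_of_length_le (by omega)]
        simp
  unfold Parsed.target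
  rw [key, List.take_of_length_le hc.length]

/-- A refutation written into the certificate is accepted. -/
theorem accepts_of_isRefutation {x : List (Fin I.m₂)} {S : Set (Fin I.k × Fin I.n₁)}
    {r : Fin I.n₁ ⊕ Fin I.n₂ → Fin I.k × Fin I.n₁ → ℕ} (h : Describes e I)
    (hc : CertifiesRefutation e I T x S r) (hr : IsRefutation I.game T x S r) :
    e.accepts = true := by
  have hT := hc.toCertifiesTransducer
  simp only [Parsed.accepts, Bool.and_eq_true]
  refine ⟨?_, (checkClosed_iff h hT).2 ⟨?_, fun p hp b => ?_⟩, (checkRanks_iff h).2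
    fun w hw p => (checkRank_iff h hT w p).2 fun hp hb b => ?_⟩
  · simp only [Parsed.checkTransducer, Bool.and_eq_true, decide_eq_true_eq, forallLT_eq_true,
      h.numStates, h.m₁, h.m₂]
    refine ⟨by rw [hc.start]; exact T.start.2, fun m hm => ⟨?_, fun b hb => ?_⟩⟩
    · have h1 := hc.label ⟨m, hm⟩
      simp only at h1
      rw [h1]
      exact (T.label _).2
    · have h1 := hc.next ⟨m, hm⟩ ⟨b, hb⟩
      simp only at h1
      rw [h1]
      exact (T.next _ _).2
  · rw [target_eq_conf h hc]
    exact (hc.mem _).2 hr.mem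
  · exact (hc.mem _).2 (hr.next_mem p ((hc.mem p).1 hp) b)
  · rw [hc.rank, hc.rank]
    have hp' := (hc.mem p).1 hp
    split_ifs with hh
    · exact hr.rank_lt w hw p hp' hb hh b
    · exact hr.rank_le w hw p hp' hb b

end Describes

/-! ### Writing certificates -/

/-- The list with the entry `g t i` at position `6 * i + t`, for `t < 6` and `i < Q`. -/
def interleave (Q : ℕ) (g : ℕ → ℕ → ℕ) : List ℕ :=
  (List.range (6 * Q)).map fun n => g (n % 6) (n / 6)

theorem getD_interleave {Q : ℕ} {g : ℕ → ℕ → ℕ} {t i : ℕ} (ht : t < 6) :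
    (interleave Q g).getD (6 * i + t) 0 = if i < Q then g t i else 0 := by
  rw [interleave, List.getD_eq_getElem?_getD, List.getElem?_map]
  split_ifs with h
  · rw [List.getElem?_range (by omega)]
    simp only [Option.map_some, Option.getD_some]
    congr 1 <;> omega
  · rw [List.getElem?_eq_none (by simp; omega)]
    rfl

theorem mul_add_inj {n a a' b b' : ℕ} (hb : b < n) (hb' : b' < n)
    (h : a * n + b = a' * n + b') : a = a' ∧ b = b' := by
  have h1 : a = a' := by
    have := congrArg (· / n) h
    simpa [Nat.add_div_of_dvd_right, Nat.mul_add_div, mul_comm _ n, (by omega : 0 < n),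
      Nat.div_eq_of_lt hb, Nat.div_eq_of_lt hb'] using this
  subst h1
  exact ⟨rfl, by omega⟩

theorem mul_add_lt_mul {a k b n : ℕ} (ha : a < k) (hb : b < n) : a * n + b < k * n := by
  have h1 : (a + 1) * n ≤ k * n := Nat.mul_le_mul_right _ ha
  rw [Nat.add_mul] at h1
  omega

theorem extend_le {α : Type} {f : α → ℕ} {g : α → ℕ} {V : ℕ} (h : ∀ a, g a ≤ V) (i : ℕ) :
    Function.extend f g 0 i ≤ V := by
  classical
  rw [Function.extend_def]
  split_ifs
  · exact h _
  · exact Nat.zero_le _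

open Classical in
/-- The entries of the certificate for a refutation. -/
noncomputable def certEntry (I : LivenessInstance)
    (T : Transducer (Fin I.m₁) (Fin I.m₂) (Fin I.k)) (x : List (Fin I.m₂))
    (S : Set (Fin I.k × Fin I.n₁)) (r : Fin I.n₁ ⊕ Fin I.n₂ → Fin I.k × Fin I.n₁ → ℕ) :
    ℕ → ℕ → ℕ
  | 0 => Function.extend Fin.val (fun m => (T.label m : ℕ)) 0
  | 1 => Function.extend (fun q : Fin I.k × Fin I.m₂ => (q.1 * I.m₂ + q.2 : ℕ))
      (fun q => (T.next q.1 q.2 : ℕ)) 0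
  | 2 => fun i => x[i]?.elim 0 fun b => (b : ℕ) + 1
  | 3 => Function.extend (fun p : Fin I.k × Fin I.n₁ => (p.1 * I.n₁ + p.2 : ℕ))
      (fun p => if p ∈ S then 1 else 0) 0
  | 4 => Function.extend (fun q : (Fin I.n₁ ⊕ Fin I.n₂) × (Fin I.k × Fin I.n₁) =>
      ((I.vertexIndex q.1 * I.k + q.2.1) * I.n₁ + q.2.2 : ℕ)) (fun q => r q.1 q.2) 0
  | _ => fun _ => T.start

/-- For instances that are not live there is a certificate of polynomial size. -/
theorem exists_certificate {I : LivenessInstance} (h : ¬ I.IsLive) :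
    ∃ c : List ℕ, c.length ≤ 6 * I.encode.length ^ 3 ∧ (∀ n ∈ c, n ≤ I.encode.length ^ 2) ∧
      ∀ N, I.encode.length ≤ N → Parsed.accepts
        (N, List.replicate I.k true :: I.gameData.map Computability.encodeNat, c) = true := by
  classical
  obtain ⟨T, x, S, r, href, hx, hr⟩ := exists_isRefutation_of_not_live h
  have hm₁ : 0 < I.m₁ := (T.label T.start).pos
  have hk : 0 < I.k := T.start.pos
  have hn₁ : 0 < I.n₁ := I.game.init.pos
  have hn₂ : 0 < I.n₂ := (I.game.E₁ I.game.init ⟨0, hm₁⟩).pos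
  set N := I.encode.length with hN
  have hlen := I.length_gameData
  have hle := I.length_gameData_le_length_encode
  have hkN : I.k ≤ N := I.k_le_length_encode
  have hm₁N : I.m₁ ≤ N := by have := Nat.le_mul_of_pos_left I.m₁ hn₁; omega
  have hm₂N : I.m₂ ≤ N := by have := Nat.le_mul_of_pos_left I.m₂ hn₂; omega
  have hnN : I.n₁ + I.n₂ ≤ N := by omega
  have hNpos : 0 < N := by omega
  have hN2 : N ≤ N ^ 2 := Nat.le_self_pow (by omega) _
  have hN3 : N ^ 2 ≤ N ^ 3 := Nat.pow_le_pow_right hNpos (by omega)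
  have hprod : ∀ {a b : ℕ}, a ≤ N → b ≤ N → a * b ≤ N ^ 2 := fun ha hb =>
    (Nat.mul_le_mul ha hb).trans (by rw [pow_two])
  have hcard : Nat.card (Fin I.k × Fin I.n₁) ≤ N ^ 2 := by
    simp only [Nat.card_prod, Nat.card_fin]
    exact hprod hkN (by omega)
  have hentry : ∀ t i, certEntry I T x S r t i ≤ N ^ 2 := by
    intro t i
    rcases t with _ | _ | _ | _ | _ | t <;> simp only [certEntry]
    · refine extend_le (fun m => ?_) i
      have := (T.label m).2
      omega
    · refine extend_le (fun q => ?_) i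
      have := (T.next q.1 q.2).2
      omega
    · cases x[i]? with
      | none => exact Nat.zero_le _
      | some b => simp only [Option.elim_some]; have := b.2; omega
    · refine extend_le (fun p => ?_) i
      split_ifs <;> omega
    · exact extend_le (fun q => (hr _ _).trans hcard) i
    · have := T.start.2
      omega
  refine ⟨interleave (N ^ 3) (certEntry I T x S r), by simp [interleave], ?_, fun N' hN' => ?_⟩
  · intro n hn
    obtain ⟨i, -, rfl⟩ := List.mem_map.1 hn
    exact hentry _ _
  set c := interleave (N ^ 3) (certEntry I T x S r) with hc
  have hd := describes_of_pos hm₁ hN' c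
  set e : Parsed := (N', List.replicate I.k true :: I.gameData.map Computability.encodeNat, c)
    with he
  have hget : ∀ {t i : ℕ}, t < 6 → i < N ^ 3 →
      e.2.2.getD (6 * i + t) 0 = certEntry I T x S r t i := fun ht hi => by
    rw [he]
    simp only
    rw [hc, getD_interleave ht, if_pos hi]
  refine accepts_of_isRefutation hd ⟨⟨?_, fun m => ?_, fun m b => ?_⟩, fun i => ?_, ?_,
    fun p => ?_, fun w p => ?_⟩ href
  · exact hget (t := 5) (i := 0) (by omega) (by omega)
  · refine (hget (t := 0) (by omega) (by have := m.2; omega)).trans ?_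
    simp only [certEntry]
    exact Fin.val_injective.extend_apply _ _ m
  · have hlt := mul_add_lt_mul m.2 b.2
    have hle2 := hprod hkN hm₂N
    rw [Parsed.certNext, hd.m₂]
    refine (hget (t := 1) (by omega) (by omega)).trans ?_
    simp only [certEntry]
    refine Function.Injective.extend_apply (f := fun q : Fin I.k × Fin I.m₂ =>
      (q.1 * I.m₂ + q.2 : ℕ)) (fun q q' hq => ?_) _ _ (m, b)
    obtain ⟨h1, h2⟩ := mul_add_inj q.2.2 q'.2.2 hq
    exact Prod.ext (Fin.ext h1) (Fin.ext h2)
  · rw [Parsed.certPath]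
    rcases lt_or_ge i (N ^ 3) with hi | hi
    · exact hget (t := 2) (by omega) hi
    · rw [List.getElem?_eq_none (by omega)]
      have h1 := getD_interleave (Q := N ^ 3) (g := certEntry I T x S r) (t := 2) (i := i)
        (by omega)
      rwa [if_neg (by omega)] at h1
  · have h1 : e.2.2.length = 6 * N ^ 3 := by simp [he, hc, interleave]
    omega
  · have hlt := mul_add_lt_mul p.1.2 p.2.2
    have hle2 := hprod hkN (b := I.n₁) (by omega)
    rw [Parsed.certMem, hd.n₁]
    have h1 := Function.Injective.extend_apply (f := fun p : Fin I.k × Fin I.n₁ =>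
      (p.1 * I.n₁ + p.2 : ℕ)) (fun q q' hq => by
        obtain ⟨h1, h2⟩ := mul_add_inj q.2.2 q'.2.2 hq
        exact Prod.ext (Fin.ext h1) (Fin.ext h2)) (fun p => if p ∈ S then 1 else 0) 0 p
    have h2 := (hget (t := 3) (by omega) (by omega)).trans h1
    rw [h2]
    split_ifs with h3 <;> simp [h3]
  · have hlt := mul_add_lt_mul (mul_add_lt_mul (vertexIndex_lt w) p.1.2) p.2.2
    have hle2 : (I.n₁ + I.n₂) * I.k * I.n₁ ≤ N ^ 3 := by
      rw [pow_succ]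
      exact Nat.mul_le_mul (hprod hnN hkN) (by omega)
    rw [Parsed.certRank, hd.n₁, hd.numStates]
    refine (hget (t := 4) (by omega) (by omega)).trans ?_
    simp only [certEntry]
    refine Function.Injective.extend_apply
      (f := fun q : (Fin I.n₁ ⊕ Fin I.n₂) × (Fin I.k × Fin I.n₁) =>
        ((I.vertexIndex q.1 * I.k + q.2.1) * I.n₁ + q.2.2 : ℕ)) (fun q q' hq => ?_) _ _ (w, p)
    obtain ⟨h1, h2⟩ := mul_add_inj q.2.2.2 q'.2.2.2 hq
    obtain ⟨h3, h4⟩ := mul_add_inj q.2.1.2 q'.2.1.2 h1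
    exact Prod.ext (vertexIndex_injective h3) (Prod.ext (Fin.ext h4) (Fin.ext h2))

/-- The verifier only accepts if player 1 has an action, because it compares the labels of the
transducer with the capped number of actions. -/
theorem pos_of_accepts {I : LivenessInstance} {N : ℕ} {c : List ℕ}
    (h : Parsed.accepts
      (N, List.replicate I.k true :: I.gameData.map Computability.encodeNat, c) = true) :
    0 < I.m₁ := by
  simp only [Parsed.accepts, Parsed.checkTransducer, Bool.and_eq_true, decide_eq_true_eq,
    forallLT_eq_true] at h
  have h1 := (h.1.2 _ h.1.1).1
  have h2 : Parsed.num
      (N, List.replicate I.k true :: I.gameData.map Computability.encodeNat, c) 2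
        = min N I.m₁ := by
    rw [Parsed.num, bitsValue_eq]
    exact congrArg _ (ofBits_encodeNat I.m₁)
  omega

end TransducerLiveness

theorem mainTheorem2 :
    TransducerLiveness.InCoNP TransducerLiveness.LivenessInstance.encode
      TransducerLiveness.LivenessInstance.IsLive := by
  open TransducerLiveness in
  refine ⟨.C 6 * .X ^ 3 * (.X ^ 2 + 1),
    fun a => verifier (encodeWithCertificate LivenessInstance.encode a),
    poly_verifier.polyTime _, fun I => ⟨fun h => ?_, ?_⟩⟩
  · obtain ⟨c, hlen, hle, hacc⟩ := exists_certificate h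
    refine ⟨certOfNumbers c, ?_, ?_⟩
    · have h1 := length_certOfNumbers_le hle
      have h2 := Nat.mul_le_mul_right (I.encode.length ^ 2 + 1) hlen
      simpa using h1.trans h2
    · simp only [verifier, parseInput_encode, certNumbers_certOfNumbers]
      exact hacc _ (Nat.le_add_right _ _)
  · rintro ⟨y, -, hy⟩
    simp only [verifier, parseInput_encode] at hy
    exact not_live_of_accepts
      (describes_of_pos (pos_of_accepts hy) (Nat.le_add_right _ _) _) hy
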